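/- **Setting.** A system model is a finite MDP $\mathcal M=(S,\mathit{Act},\mathbf P,s_0,\mathit{AP},L)$ with $\sum_{s'}\mathbf P(s,a,s')\in\{0,1\}$ for all $s,a$ (the action $a$ is enabled at $s$ iff the sum is $1$), in which every state has an enabled action. A strategy is a function $\sigma:S\to\mathit{Act}$ that chooses enabled actions; $\Pr^\sigma_s$ is the probability measure on the infinite paths of the induced Markov chain started at $s$. Let $R$ be the set of states reachable from $s_0$ under any strategy. For $B\subseteq S$ put $x_B(s)=\sup_\sigma \Pr^\sigma_s(\Diamond\Box B)$, where $\Diamond\Box B$ means "eventually always $B$". A persistence CAPTL requirement $\mathcal A$ consists of a finite set $Q$ of objectives, an initial objective $q_0$, a finite set $W$ of contexts and conditional transitions $q\xrightarrow{w}q'$, written $q'=Q(q,w)$, where $W(q)$ is the set of contexts leaving $q$. Every objective is a query $q=\mathsf P_{\max}[\Diamond\Box B_q]$ with $B_q\subseteq S$. Every $w\in W(q)$ is a query $\mathsf P_{\max\in J_w}[\Diamond\Box B_q]$ with an interval $J_w$; it leads to one objective $Q(q,w)\ne q$, and different contexts in $W(q)$ lead to different objectives. The intervals $J_w$, $w\in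 W(q)$, are pairwise disjoint and, if $W(q)\neq\emptyset$, their union is $[0,c_q)$ for some $0<c_q\le 1$. Write $x_q=x_{B_q}$. A state $s$ satisfies $w\in W(q)$ if $x_q(s)\in J_w$, and satisfies $q$ if $x_q(s)=1$. **Optimal protocols.** Let $(\sigma_q)_{q\in Q}$ be strategies such that $\Pr^{\sigma_q}_s(\Diamond\Box B_q)=x_q(s)$ for all $q\in Q$, $s\in R$. The active pairs $(q,s)$ are the smallest set that contains $(q_0,s_0)$ and, with $(q,s)$, contains: $(Q(q,w),s)$ if $s$ satisfies $w\in W(q)$; and $(q,s')$ for all $s'$ with $\mathbf P(s,\sigma_q(s),s')>0$ if $s$ satisfies no context in $W(q)$. The induced protocol is the partial function $\Pi:Q\times S\rightharpoonup \mathit{Act}\cup W$ defined exactly on the active pairs, with $\Pi(q,s)=w$ if $s$ satisfies $w\in W(q)$, and $\Pi(q,s)=\sigma_q(s)$ if $s$ satisfies no context in $W(q)$. A protocol induced in this way is called an optimal protocol. The composition $\mathcal M^\Pi$ has states $Q\times S$ and initial state $(q_0,s_0)$. It moves from $(q,s)$ to $(q,s')$ with probability $\mathbf P(s,a,s')$ if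 $\Pi(q,s)=a\in\mathit{Act}$, and to $(Q(q,w),s)$ with probability $1$ if $\Pi(q,s)=w\in W$. We write $\mathcal M,\Pi\models_c\mathcal A$ if the probability in $\mathcal M^\Pi$ of reaching some $(q,s)$ such that $s$ satisfies $q$ is equal to $c$. **Procedure.** *First part.* Start with $\hat Q=\{q_0\}$, $\bar Q=\emptyset$ and all $R_q^{q'}=\emptyset$. While $\hat Q\ne\emptyset$: pick $q\in\hat Q$, move it to $\bar Q$ and set $R_q^q:=R$. Let the model checker return a strategy $\sigma_q$ with $\Pr^{\sigma_q}_s(\Diamond\Box B_q)=x_q(s)$ for all $s\in R$, together with the vector $x_q$. For each $w\in W(q)$, with $q'=Q(q,w)$, set $R_q^{q'}:=\{s\in R: x_q(s)\in J_w\}$ and $R_q^q:=R_q^q\setminus R_q^{q'}$, and add $q'$ to $\hat Q$ if $R_q^{q'}\neq\emptyset$ and $q'\notin\bar Q$. *Second part.* Construct the composed model $\mathcal M_{\mathcal A}^\sigma$ with states $(s,q,\gamma)$, $\gamma\in\{1,2\}$, initial state $(s_0,q_0,2)$ and these transitions: $(s,q,1)\to(s',q,2)$ with action $a=\sigma_q(s)$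 and probability $\mathbf P(s,a,s')$; $(s,q,2)\to(s,q,1)$ with the stutter action $\tau$ if $s\in R_q^q$; $(s,q,2)\to(s,q',2)$ with action $w$ if $q'=Q(q,w)$ and $s\in R_q^{q'}$. Let the model checker return a strategy of $\mathcal M_{\mathcal A}^\sigma$ and the probability $c$, under it, of $\bigvee_{q\in Q}\Diamond\Box(\text{the current objective is }q\text{ and the current state is in }B_q)$. Return $(\Pi,c)$, where $\Pi$ is read off from this strategy at the reachable states $(s,q,2)$: $\Pi(q,s)$ is the context chosen at $(s,q,2)$ or, if $\tau$ is chosen there, the system action chosen at $(s,q,1)$. **Theorem.** For every system model $\mathcal M$ and persistence CAPTL requirement $\mathcal A$, the procedure terminates: whatever the order of its choices and whichever correct answers the model checker gives, no execution is infinite, and every execution can be continued until it returns a result (in particular, the required strategies exist). For every partial function $\Pi:Q\times S\rightharpoonup\mathit{Act}\cup W$ and every $c\in\mathbb R$, the procedure can return $(\Pi,c)$ if and only if $\Pi$ is an optimal protocol and $\mathcal M,\Pi\models_c\mathcal A$. -/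

import Mathlib

open MeasureTheory ProbabilityTheory
open scoped NNReal ENNReal

/-! ## Finite Markov chains -/

namespace PathSpace

variable {V : Type*}

/-- The one-step kernel of the homogeneous Markov chain with transition law `K`: the next state
is drawn according to the law attached to the last state of the history. -/
noncomputable def stepKernel [Countable V] [MeasurableSpace V] [MeasurableSingletonClass V]
    (K : V → PMF V) (n : ℕ) : Kernel (Π _ : Finset.Iic n, V) V where
  toFun h := (K (h ⟨n, Finset.mem_Iic.2 le_rfl⟩)).toMeasure
  measurable' := measurable_from_top (f := fun v : V => (K v).toMeasure) |>.comp
    (by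
      have h : (inferInstance : MeasurableSpace V) = ⊤ := by
        ext s
        simp [Set.Countable.measurableSet (Set.to_countable s)]
      have h2 := measurable_pi_apply (X := fun _ : Finset.Iic n => V)
        ⟨n, Finset.mem_Iic.2 le_rfl⟩
      convert h2
      exact h.symm)

instance [Countable V] [MeasurableSpace V] [MeasurableSingletonClass V]
    (K : V → PMF V) (n : ℕ) : IsMarkovKernel (stepKernel K n) :=
  ⟨fun _ => PMF.toMeasure.isProbabilityMeasure _⟩

/-- The law on infinite state sequences of the Markov chain `K` started in `v`. -/
noncomputable def pathMeasure [Countable V] [MeasurableSpace V] [MeasurableSingletonClass V]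
    (K : V → PMF V) (v : V) : Measure (ℕ → V) :=
  Kernel.traj (X := fun _ => V) (stepKernel K) 0 (fun _ => v)

/-- The probability of a set `E` of infinite state sequences, for the chain `K` started in `v`
(the state space carries the discrete σ-algebra, sequences the product σ-algebra). -/
noncomputable def pathProb [Countable V] (K : V → PMF V) (v : V) (E : Set (ℕ → V)) : ℝ :=
  letI : MeasurableSpace V := ⊤
  (pathMeasure K v).real E

/-- The sequences satisfying "eventually always `B`". -/
def eventuallyAlways (B : Set V) : Set (ℕ → V) := {ω | ∃ n, ∀ m, n ≤ m → ω m ∈ B}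

end PathSpace

open PathSpace

/-! ## Markov decision processes -/

/-- A system model: transition probabilities whose rows sum to `0` (action not enabled) or `1`
(action enabled), an initial state, and a labelling by atomic propositions. -/
structure MDP (S Act AP : Type*) [Fintype S] where
  P : S → Act → S → ℝ≥0
  sum_P : ∀ s a, ∑ s', P s a s' = 0 ∨ ∑ s', P s a s' = 1
  init : S
  label : S → Set AP

namespace MDP

variable {S Act AP : Type*} [Fintype S] (M : MDP S Act AP)

/-- `a ∈ Act(s)`. -/
def Enabled (s : S) (a : Act) : Prop := ∑ s', M.P s a s' = 1

/-- Every state has an enabled action. -/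
def NoDeadlock : Prop := ∀ s, ∃ a, M.Enabled s a

/-- A pure memoryless strategy; it chooses an enabled action wherever there is one. -/
def Strategy : Type _ := {σ : S → Act // ∀ s, (∃ a, M.Enabled s a) → M.Enabled s (σ s)}

/-- The Markov chain induced by a strategy. A state in which no action is enabled is terminal; as
usual, the chain then stays there. -/
noncomputable def chain (σ : M.Strategy) (s : S) : PMF S :=
  open Classical in
  if h : M.Enabled s (σ.1 s) then
    PMF.ofFintype (fun s' => (M.P s (σ.1 s) s' : ℝ≥0∞))
      (by have h' : ∑ s', M.P s (σ.1 s) s' = 1 := h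
          exact_mod_cast h')
  else PMF.pure s

/-- The probability, from `s` and under `σ`, of a set of infinite paths. -/
noncomputable def prob (σ : M.Strategy) (s : S) (E : Set (ℕ → S)) : ℝ := pathProb (M.chain σ) s E

/-- The maximal probability, from `s`, of a set of infinite paths. -/
noncomputable def maxProb (s : S) (E : Set (ℕ → S)) : ℝ := ⨆ σ : M.Strategy, M.prob σ s E

/-- States reachable from `s` (under any strategy). -/
def Reach (s : S) : Set S := {t | Relation.ReflTransGen (fun u v => ∃ a, 0 < M.P u a v) s t}

/-- States reachable from `s` under the strategy `σ`. -/
def ReachUnder (σ : M.Strategy) (s : S) : Set S :=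
  {t | Relation.ReflTransGen (fun u v => 0 < M.P u (σ.1 u) v) s t}

/-- The value, at `s`, of the persistence objective "maximize the probability of eventually
always `B`". -/
noncomputable def persistenceValue (B : Set S) (s : S) : ℝ := M.maxProb s (eventuallyAlways B)

/-- `σ` is a local (optimal) strategy, at `s`, for the persistence objective with set `B`. -/
def IsLocalStrategy (B : Set S) (s : S) (σ : M.Strategy) : Prop :=
  M.prob σ s (eventuallyAlways B) = M.persistenceValue B s

end MDP

/-! ## CAPTL requirements -/

/-- A CAPTL requirement all of whose objectives and contexts are persistence queries. `Q` is the
set of objectives, the objective `q` being `P_max [◇□ (objSet q)]`; `W` is the set of contexts, the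
context `w` being `P_{max ∈ ctxInt w} [◇□ (ctxSet w)]`; `next q w = some q'` says that there is a
conditional transition from `q` to `q'` labelled `w`. The sets of states are those in which the
state formulas hold. -/
structure CAPTL (S Q W : Type*) where
  objSet : Q → Set S
  ctxSet : W → Set S
  ctxInt : W → Set ℝ
  next : Q → W → Option Q
  init : Q

namespace CAPTL

variable {S Q W : Type*} (A : CAPTL S Q W)

/-- The contexts `W(q)` emerging from the objective `q`. -/
def contexts (q : Q) : Set W := {w | ∃ q', A.next q w = some q'}

/-- Persistence CAPTL: the contexts of an objective are over its own persistence set, there is one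
for each target objective, leading to a different objective, and the intervals of the contexts
of an objective are disjoint with union `[0, c)`, `0 < c ≤ 1`. -/
structure IsPersistence : Prop where
  ctxSet_eq : ∀ q, ∀ w ∈ A.contexts q, A.ctxSet w = A.objSet q
  next_ne : ∀ q w, A.next q w ≠ some q
  next_inj : ∀ q w w' q', A.next q w = some q' → A.next q w' = some q' → w = w'
  interval : ∀ q, ∀ w ∈ A.contexts q, (A.ctxInt w).OrdConnected
  disjoint : ∀ q, (A.contexts q).PairwiseDisjoint A.ctxInt
  union : ∀ q, (A.contexts q).Nonempty →
    ∃ c : ℝ, 0 < c ∧ c ≤ 1 ∧ ⋃ w ∈ A.contexts q, A.ctxInt w = Set.Ico 0 c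

end CAPTL

/-- A protocol: a partial function assigning to an objective and a state either an action or a
context (to switch the objective). -/
abbrev Protocol (S Act Q W : Type*) := Q → S → Option (Act ⊕ W)

section Semantics

variable {S Act AP Q W : Type*} [Fintype S]

/-- The state `s` satisfies the context `w`. -/
def SatContext (M : MDP S Act AP) (A : CAPTL S Q W) (s : S) (w : W) : Prop :=
  M.persistenceValue (A.ctxSet w) s ∈ A.ctxInt w

/-- The state `s` satisfies the objective `q`: the optimum of the query is `1`. -/
def SatObjective (M : MDP S Act AP) (A : CAPTL S Q W) (s : S) (q : Q) : Prop :=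
  M.persistenceValue (A.objSet q) s = 1

/-- `Active M A σ q s`: the objective `q` is active (being pursued) at the state `s`, when each
objective is pursued by its strategy in the profile `σ`, until a context of it is satisfied. -/
inductive Active (M : MDP S Act AP) (A : CAPTL S Q W) (σ : Q → M.Strategy) : Q → S → Prop
  | init : Active M A σ A.init M.init
  | move {q s s'} : Active M A σ q s → (∀ w ∈ A.contexts q, ¬ SatContext M A s w) →
      0 < M.P s ((σ q).1 s) s' → Active M A σ q s'
  | switch {q s w q'} : Active M A σ q s → A.next q w = some q' → SatContext M A s w →
      Active M A σ q' s

/-- The switching set of `q`: the states in which `q` is active and some context of it holds. -/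
def switchingSet (M : MDP S Act AP) (A : CAPTL S Q W) (σ : Q → M.Strategy) (q : Q) : Set S :=
  {s | Active M A σ q s ∧ ∃ w ∈ A.contexts q, SatContext M A s w}

/-- `Π` is the protocol induced by the strategy profile `σ`. -/
def IsInducedProtocol (M : MDP S Act AP) (A : CAPTL S Q W) (σ : Q → M.Strategy)
    (Pr : Protocol S Act Q W) : Prop :=
  (∀ q s a, Pr q s = some (Sum.inl a) ↔
    Active M A σ q s ∧ s ∉ switchingSet M A σ q ∧ (σ q).1 s = a) ∧
  (∀ q s w, Pr q s = some (Sum.inr w) ↔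
    Active M A σ q s ∧ w ∈ A.contexts q ∧ SatContext M A s w)

/-- The optimal protocols: those induced by a strategy profile in which the strategy of each
objective is a local strategy for this objective at every reachable state. -/
def IsOptimalProtocol (M : MDP S Act AP) (A : CAPTL S Q W) (Pr : Protocol S Act Q W) : Prop :=
  ∃ σ : Q → M.Strategy,
    (∀ q, ∀ s ∈ M.Reach M.init, M.IsLocalStrategy (A.objSet q) s (σ q)) ∧
    IsInducedProtocol M A σ Pr

open Classical in
/-- Transition probabilities of the composition of a system and a protocol. -/
noncomputable def protocolP (M : MDP S Act AP) (A : CAPTL S Q W) (Pr : Protocol S Act Q W) :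
    Q × S → Act ⊕ W → Q × S → ℝ≥0
  | (q, s), Sum.inl a, (q', s') => if Pr q s = some (Sum.inl a) ∧ q' = q then M.P s a s' else 0
  | (q, s), Sum.inr w, (q', s') =>
      if Pr q s = some (Sum.inr w) ∧ s' = s ∧ A.next q w = some q' then 1 else 0

theorem sum_ite_zero_or_one {V : Type*} [Fintype V] (v : V) (p : V → Prop) [DecidablePred p]
    (h : ∀ u, p u → u = v) :
    ∑ u, (if p u then (1 : ℝ≥0) else 0) = 0 ∨ ∑ u, (if p u then (1 : ℝ≥0) else 0) = 1 := by
  classical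
  by_cases hv : p v
  · right
    rw [Finset.sum_eq_single v]
    · simp [hv]
    · intro u _ hu
      exact if_neg fun hp => hu (h u hp)
    · simp
  · left
    refine Finset.sum_eq_zero fun u _ => if_neg fun hp => hv ?_
    rw [← h u hp]
    exact hp

theorem sum_protocolP [Fintype Q] (M : MDP S Act AP) (A : CAPTL S Q W)
    (Pr : Protocol S Act Q W) (v : Q × S) (α : Act ⊕ W) :
    ∑ v', protocolP M A Pr v α v' = 0 ∨ ∑ v', protocolP M A Pr v α v' = 1 := by
  classical
  obtain ⟨q, s⟩ := v
  rcases α with a | w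
  · by_cases h : Pr q s = some (Sum.inl a)
    · have : ∑ v', protocolP M A Pr (q, s) (Sum.inl a) v' = ∑ s', M.P s a s' := by
        rw [Fintype.sum_prod_type, Finset.sum_eq_single q]
        · simp [protocolP, h]
        · intro q' _ hq
          simp [protocolP, hq]
        · simp
      rw [this]
      exact M.sum_P s a
    · left
      exact Finset.sum_eq_zero fun v' _ => by simp [protocolP, h]
  · refine sum_ite_zero_or_one ((A.next q w).getD q, s)
      (fun v' : Q × S => Pr q s = some (Sum.inr w) ∧ v'.2 = s ∧ A.next q w = some v'.1) ?_
    rintro ⟨q', s'⟩ ⟨_, rfl, h⟩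
    simp only at h
    simp [h]

/-- The composition of a system and a protocol. Where the protocol is undefined, there is no
transition. -/
noncomputable def protocolMDP [Fintype Q] (M : MDP S Act AP) (A : CAPTL S Q W)
    (Pr : Protocol S Act Q W) : MDP (Q × S) (Act ⊕ W) AP where
  P := protocolP M A Pr
  sum_P := sum_protocolP M A Pr
  init := (A.init, M.init)
  label v := M.label v.2

/-- CAPTL satisfaction, with value `c`: the (maximal) probability, in the composition of the
system and the protocol, of reaching a pair of an objective and a state satisfying it is `c`. -/
def Satisfies [Fintype Q] (M : MDP S Act AP) (A : CAPTL S Q W) (Pr : Protocol S Act Q W)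
    (c : ℝ) : Prop :=
  (protocolMDP M A Pr).maxProb (A.init, M.init)
    {ω | ∃ n, SatObjective M A (ω n).2 (ω n).1} = c

end Semantics

/-! ## The composition of a system and a requirement -/

/-- Whose turn it is in the composed model. -/
inductive Turn
  | system
  | requirement
  deriving DecidableEq

instance : Fintype Turn where
  elems := {Turn.system, Turn.requirement}
  complete t := by cases t <;> decide

/-- The actions of the composed model: system actions, contexts, and a stutter action. -/
inductive CompAct (Act W : Type*)
  | act (a : Act)
  | ctx (w : W)
  | tau

section Composition

variable {S Act AP Q W : Type*} [Fintype S]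

open Classical in
/-- Transition probabilities of the composed model, for a family `part q q'` of sets of states
(those where `q` is kept, if `q' = q`, or switched to `q'`) and a partial strategy profile. -/
noncomputable def compP (M : MDP S Act AP) (A : CAPTL S Q W) (part : Q → Q → Set S)
    (strat : Q → Option M.Strategy) :
    S × Q × Turn → CompAct Act W → S × Q × Turn → ℝ≥0
  | (s, q, Turn.system), CompAct.act a, (s', q', Turn.requirement) =>
      if q' = q ∧ ∃ σ, strat q = some σ ∧ σ.1 s = a then M.P s a s' else 0
  | (s, q, Turn.requirement), CompAct.tau, (s', q', Turn.system) =>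
      if s' = s ∧ q' = q ∧ s ∈ part q q then 1 else 0
  | (s, q, Turn.requirement), CompAct.ctx w, (s', q', Turn.requirement) =>
      if s' = s ∧ A.next q w = some q' ∧ s ∈ part q q' then 1 else 0
  | _, _, _ => 0

theorem sum_turn (f : Turn → ℝ≥0) : ∑ t, f t = f Turn.system + f Turn.requirement := by
  have : (Finset.univ : Finset Turn) = {Turn.system, Turn.requirement} := rfl
  rw [this, Finset.sum_pair (by decide)]

theorem sum_compP [Fintype Q] (M : MDP S Act AP) (A : CAPTL S Q W) (part : Q → Q → Set S)
    (strat : Q → Option M.Strategy) (v : S × Q × Turn) (α : CompAct Act W) :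
    ∑ v', compP M A part strat v α v' = 0 ∨ ∑ v', compP M A part strat v α v' = 1 := by
  classical
  obtain ⟨s, q, t⟩ := v
  have key : ∑ v', compP M A part strat (s, q, t) α v' =
      ∑ x : S × Q, (compP M A part strat (s, q, t) α (x.1, x.2, Turn.system) +
        compP M A part strat (s, q, t) α (x.1, x.2, Turn.requirement)) := by
    simp only [Fintype.sum_prod_type, sum_turn]
  rw [key]
  cases t with
  | system =>
    cases α with
    | act a =>
      by_cases h : ∃ σ, strat q = some σ ∧ σ.1 s = a
      · have : ∑ x : S × Q, (compP M A part strat (s, q, Turn.system) (CompAct.act a)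
              (x.1, x.2, Turn.system) +
            compP M A part strat (s, q, Turn.system) (CompAct.act a)
              (x.1, x.2, Turn.requirement)) = ∑ s', M.P s a s' := by
          rw [Fintype.sum_prod_type]
          refine Finset.sum_congr rfl fun s' _ => ?_
          rw [Finset.sum_eq_single q]
          · simp only [compP, zero_add]
            simp [h]
          · intro q' _ hq
            simp [compP, hq]
          · simp
        rw [this]
        exact M.sum_P s a
      · left
        refine Finset.sum_eq_zero fun x _ => ?_
        simp only [compP, zero_add]
        exact if_neg fun h' => h h'.2
    | ctx w => left; simp [compP]
    | tau => left; simp [compP]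
  | requirement =>
    cases α with
    | act a => left; simp [compP]
    | ctx w =>
      simp only [compP, zero_add]
      refine sum_ite_zero_or_one (s, (A.next q w).getD q)
        (fun x : S × Q => x.1 = s ∧ A.next q w = some x.2 ∧ s ∈ part q x.2) ?_
      rintro ⟨s', q'⟩ ⟨rfl, h, _⟩
      simp only at h
      simp [h]
    | tau =>
      simp only [compP, add_zero]
      refine sum_ite_zero_or_one (s, q)
        (fun x : S × Q => x.1 = s ∧ x.2 = q ∧ s ∈ part q q) ?_
      rintro ⟨s', q'⟩ ⟨rfl, rfl, _⟩
      rfl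

/-- The composed model. -/
noncomputable def compMDP [Fintype Q] (M : MDP S Act AP) (A : CAPTL S Q W)
    (part : Q → Q → Set S) (strat : Q → Option M.Strategy) :
    MDP (S × Q × Turn) (CompAct Act W) AP where
  P := compP M A part strat
  sum_P := sum_compP M A part strat
  init := (M.init, A.init, Turn.requirement)
  label v := M.label v.1

open Classical in
/-- The protocol read off from a strategy `ρ` of the composed model: it is defined at the pairs
`(q, s)` whose requirement-turn state is reachable; it is the context chosen there or, if the
stutter action is chosen, the system action chosen in the system-turn state. -/
noncomputable def readProtocol [Fintype Q] (N : MDP (S × Q × Turn) (CompAct Act W) AP)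
    (ρ : N.Strategy) : Protocol S Act Q W := fun q s =>
  if (s, q, Turn.requirement) ∈ N.ReachUnder ρ N.init then
    match ρ.1 (s, q, Turn.requirement), ρ.1 (s, q, Turn.system) with
    | CompAct.ctx w, _ => some (Sum.inr w)
    | CompAct.tau, CompAct.act a => some (Sum.inl a)
    | _, _ => none
  else none

/-- The paths of the composed model satisfying `⋁_q ◇□ (q is active and B_q holds)`. -/
def compEvent (A : CAPTL S Q W) : Set (ℕ → S × Q × Turn) :=
  ⋃ q, eventuallyAlways {v | v.2.1 = q ∧ v.1 ∈ A.objSet q}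

end Composition

/-! ## The synthesis procedure -/

section Algorithm

variable {S Act AP Q W : Type*} [Fintype S] [Fintype Q]

/-- The program variables of the first part of the procedure. -/
structure Store (M : MDP S Act AP) (Q : Type*) where
  /-- the sets `R_q^{q'}` -/
  part : Q → Q → Set S
  /-- the objectives waiting to be processed -/
  todo : Set Q
  /-- the objectives whose processing has begun -/
  seen : Set Q
  /-- the synthesized strategies -/
  strat : Q → Option M.Strategy
  /-- the value vectors -/
  val : Q → S → ℝ

/-- Configurations: at the head of the while loop; in the foreach loop for the objective `q`, with
the contexts in `rest` still to be treated; composed model constructed; result returned. -/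
inductive Config (M : MDP S Act AP) (Q W : Type*) [Fintype Q]
  | whileLoop (st : Store M Q)
  | forLoop (st : Store M Q) (q : Q) (rest : Set W)
  | built (N : MDP (S × Q × Turn) (CompAct Act W) AP)
  | returned (Pr : Protocol S Act Q W) (c : ℝ)

/-- The initial configuration. -/
def Config.start (M : MDP S Act AP) (A : CAPTL S Q W) : Config M Q W :=
  .whileLoop
    { part := fun _ _ => ∅
      todo := {A.init}
      seen := ∅
      strat := fun _ => none
      val := fun _ _ => 0 }

open Classical in
/-- Start processing `q`: move it from `todo` to `seen`, set `R_q^q` to the set of all reachable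
states, and store the strategy `σ` and the value vector of `q`. -/
noncomputable def Store.enter {M : MDP S Act AP} (A : CAPTL S Q W) (st : Store M Q) (q : Q)
    (σ : M.Strategy) : Store M Q where
  part := Function.update st.part q (Function.update (st.part q) q (M.Reach M.init))
  todo := st.todo \ {q}
  seen := st.seen ∪ {q}
  strat := Function.update st.strat q (some σ)
  val := Function.update st.val q (M.persistenceValue (A.objSet q))

open Classical in
/-- Treat the context `w`, leading from `q` to `q'`: assign `R_q^{q'}`, then remove it from
`R_q^q`, then add `q'` to `todo` if `R_q^{q'}` is non-empty and `q'` is not in `seen`. -/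
noncomputable def Store.treat {M : MDP S Act AP} (A : CAPTL S Q W) (st : Store M Q) (q : Q)
    (w : W) (q' : Q) : Store M Q :=
  let new : Set S := {s ∈ M.Reach M.init | st.val q s ∈ A.ctxInt w}
  let row : Q → Set S := Function.update (st.part q) q' new
  { part := Function.update st.part q (Function.update row q (row q \ row q'))
    todo := if new.Nonempty ∧ q' ∉ st.seen then st.todo ∪ {q'} else st.todo
    seen := st.seen
    strat := st.strat
    val := st.val }

/-- One step of the procedure. Nondeterminism: the order in which the objectives and contexts are
picked, and which correct answer the model checker gives. For an objective `q`, a correct answer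
of the synthesis function is a strategy that is optimal for `q` at the initial state and at
all other reachable states; for the composed model it is any strategy, with the probability
of the query under this strategy. -/
inductive Step (M : MDP S Act AP) (A : CAPTL S Q W) : Config M Q W → Config M Q W → Prop
  | enter {st : Store M Q} {q : Q} {σ : M.Strategy} : q ∈ st.todo →
      (∀ s ∈ M.Reach M.init, M.IsLocalStrategy (A.objSet q) s σ) →
      Step M A (.whileLoop st) (.forLoop (st.enter A q σ) q (A.contexts q))
  | treat {st : Store M Q} {q : Q} {rest : Set W} {w : W} {q' : Q} : w ∈ rest →
      A.next q w = some q' →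
      Step M A (.forLoop st q rest) (.forLoop (st.treat A q w q') q (rest \ {w}))
  | leave {st : Store M Q} {q : Q} :
      Step M A (.forLoop st q ∅) (.whileLoop st)
  | build {st : Store M Q} : st.todo = ∅ →
      Step M A (.whileLoop st) (.built (compMDP M A st.part st.strat))
  | synth {N : MDP (S × Q × Turn) (CompAct Act W) AP} (ρ : N.Strategy) :
      Step M A (.built N)
        (.returned (readProtocol N ρ) (N.prob ρ (M.init, A.init, Turn.requirement) (compEvent A)))

/-- A configuration in which the procedure has returned a result. -/
def Config.IsReturned {M : MDP S Act AP} : Config M Q W → Prop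
  | .returned _ _ => True
  | _ => False

/-- The procedure terminates: no execution is infinite, and an execution that has not returned
a result can be continued. -/
def Terminates (M : MDP S Act AP) (A : CAPTL S Q W) : Prop :=
  (¬ ∃ f : ℕ → Config M Q W, f 0 = Config.start M A ∧ ∀ n, Step M A (f n) (f (n + 1))) ∧
  ∀ C, Relation.ReflTransGen (Step M A) (Config.start M A) C → C.IsReturned ∨ ∃ C', Step M A C C'

/-- The procedure returns `(Π, c)` (for some choices and correct answers of the model checker). -/
def Returns (M : MDP S Act AP) (A : CAPTL S Q W) (Pr : Protocol S Act Q W) (c : ℝ) : Prop :=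
  Relation.ReflTransGen (Step M A) (Config.start M A) (.returned Pr c)

end Algorithm

/-! The local strategies are the only answers of the model checker that influence the result. When
the first part ends, the sets `R_q^{q'}` of every processed objective are exactly the reachable
states satisfying the corresponding context, `R_q^q` collects those satisfying none, and every
objective that can become active has been processed (`Store.Invariant`, `Realizes`). Since the
intervals are disjoint, exactly one action then has successors at each composed state that can
occur. So every strategy of the composed model yields the protocol induced by the stored profile
(`isInducedProtocol_readProtocol`). Conversely, if the model checker answers with the profile of a
given optimal protocol, that protocol is what is read off.

The value rests on two facts. In a finite chain, "eventually always `D`" is as likely as visiting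
the core of `D`, its largest closed subset (`pathProb_iUnion_eventuallyAlways`). And a local
strategy never leaves the states of value one, where no context can hold because the intervals lie
in `[0, c)` with `c ≤ 1`. Hence a satisfied objective is never abandoned, and its persistence event
has probability one from there on. Conversely, at an occurring state in the core of "`q` is current
and `B_q` holds", the strategy of `q` is followed forever inside `B_q`, so `q` has value one. Thus
the composed event has the probability of reaching a satisfied objective (`prob_compEvent`). The
composition with the protocol differs only by stutter steps and has the same reachability
probability (`reachProb_protocolMDP_eq`). These comparisons use that a reachability probability is
the least nonnegative superharmonic function that is at least one on the target
(`reachProb_le_of_superharmonic`).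

Optimal memoryless strategies exist by policy improvement (`exists_persistence_maximal`). The
procedure halts because each round of the while loop uses up an unseen objective and treats finitely
many contexts (`Step.steps_lt`). -/

set_option linter.unusedSectionVars false

/-! ### Path measures and the Markov property -/

namespace PathSpace

/-- The sequence `ω` preceded by `v`. -/
def consPath {V : Type*} (v : V) (ω : ℕ → V) : ℕ → V
  | 0 => v
  | n + 1 => ω n

/-- A finite measure on sequences is the unique projective limit of its finite marginals. Every
finite set of times lies in an initial segment, and over a countable state space the law of an
initial segment is determined by its atoms, the prefixes. -/
theorem measure_ext_of_prefixes {V : Type*} [Countable V] [MeasurableSpace V]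
    [MeasurableSingletonClass V] {μ ν : Measure (ℕ → V)} [IsFiniteMeasure μ]
    (h : ∀ (n : ℕ) (a : ℕ → V), μ {ω | ∀ i ≤ n, ω i = a i} = ν {ω | ∀ i ≤ n, ω i = a i}) :
    μ = ν := by
  have hmap : ∀ n, μ.map (Preorder.frestrictLe n) = ν.map (Preorder.frestrictLe n) := by
    intro n
    refine Measure.ext_of_singleton fun x => ?_
    rw [Measure.map_apply (Preorder.measurable_frestrictLe n) (measurableSet_singleton x),
      Measure.map_apply (Preorder.measurable_frestrictLe n) (measurableSet_singleton x)]
    have hx : Preorder.frestrictLe (π := fun _ => V) n ⁻¹' {x} =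
        {ω | ∀ i ≤ n, ω i = if h : i ≤ n then x ⟨i, Finset.mem_Iic.2 h⟩ else ω i} := by
      ext ω
      simp only [Set.mem_preimage, Set.mem_singleton_iff, Set.mem_ofPred_eq]
      constructor
      · rintro rfl i hi
        simp [hi]
      · intro h
        funext ⟨i, hi⟩
        have hi' := Finset.mem_Iic.1 hi
        simpa [hi'] using h i hi'
    -- The values past `n` are irrelevant, but to apply `h` they must not depend on `ω`; `x n`
    -- serves as a filler without choosing an element of `V`.
    have hx2 : Preorder.frestrictLe (π := fun _ => V) n ⁻¹' {x} =
        {ω | ∀ i ≤ n, ω i =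
          if h : i ≤ n then x ⟨i, Finset.mem_Iic.2 h⟩ else x ⟨n, Finset.mem_Iic.2 le_rfl⟩} := by
      rw [hx]
      ext ω
      refine forall₂_congr fun i hi => ?_
      simp [hi]
    rw [hx2]
    exact h n _
  have huniv : IsProjectiveLimit μ fun I => μ.map I.restrict := fun _ => rfl
  refine huniv.unique fun I => ?_
  have hI : I ⊆ Finset.Iic (I.sup id) := Finset.subset_Iic_sup_id I
  have hr : (I.restrict : (ℕ → V) → _) =
      Finset.restrict₂ hI ∘ Preorder.frestrictLe (I.sup id) := rfl
  rw [hr, ← Measure.map_map (Finset.measurable_restrict₂ _) (Preorder.measurable_frestrictLe _),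
    ← hmap, Measure.map_map (Finset.measurable_restrict₂ _) (Preorder.measurable_frestrictLe _)]
  rfl

theorem measurableSet_prefix {V : Type*} [MeasurableSpace V] [MeasurableSingletonClass V]
    (n : ℕ) (a : ℕ → V) :
    MeasurableSet {ω : ℕ → V | ∀ i ≤ n, ω i = a i} := by
  have : {ω : ℕ → V | ∀ i ≤ n, ω i = a i} = ⋂ i, ⋂ (_ : i ≤ n), (fun ω => ω i) ⁻¹' {a i} := by
    ext; simp
  rw [this]
  exact MeasurableSet.iInter fun i => MeasurableSet.iInter fun _ =>
    measurable_pi_apply i (measurableSet_singleton _)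

theorem measurable_consPath {V : Type*} [MeasurableSpace V] (v : V) : Measurable (consPath v) := by
  refine measurable_pi_lambda _ fun n => ?_
  cases n with
  | zero => exact measurable_const
  | succ n => exact measurable_pi_apply n

section Measure

variable {V : Type*} [Countable V] [MeasurableSpace V] [MeasurableSingletonClass V]

instance (K : V → PMF V) (v : V) : IsProbabilityMeasure (pathMeasure K v) := by
  unfold pathMeasure; infer_instance

theorem pathMeasure_prefix_zero (K : V → PMF V) (v : V) (a : ℕ → V) :
    pathMeasure K v {ω | ∀ i ≤ 0, ω i = a i} = Set.indicator {v} 1 (a 0) := by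
  classical
  have h := Kernel.traj_map_frestrictLe_apply (X := fun _ => V) (κ := stepKernel K) 0 0
    (fun _ => v)
  rw [Kernel.partialTraj_self, Kernel.id_apply] at h
  have hm := congrArg (fun μ => μ {x | x ⟨0, Finset.mem_Iic.2 le_rfl⟩ = a 0}) h
  have hs : MeasurableSet {x : ∀ _ : Finset.Iic 0, V |
      x ⟨0, Finset.mem_Iic.2 le_rfl⟩ = a 0} :=
    measurable_pi_apply _ (measurableSet_singleton _)
  beta_reduce at hm
  rw [Measure.map_apply (Preorder.measurable_frestrictLe 0) hs, Measure.dirac_apply' _ hs] at hm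
  have : {ω : ℕ → V | ∀ i ≤ 0, ω i = a i} =
    Preorder.frestrictLe (π := fun _ => V) 0 ⁻¹' {x | x ⟨0, Finset.mem_Iic.2 le_rfl⟩ = a 0} := by
    ext; simp
  rw [this, pathMeasure, hm]
  simp [Set.indicator_apply, eq_comm]

/-- The joint law of the history up to `n` and the next state is the composition product of the
history law with `stepKernel`; this evaluates it on one atom. -/
theorem pathMeasure_prefix_succ (K : V → PMF V) (v : V) (a : ℕ → V) (n : ℕ) :
    pathMeasure K v {ω | ∀ i ≤ n + 1, ω i = a i} =
      pathMeasure K v {ω | ∀ i ≤ n, ω i = a i} * K (a n) (a (n + 1)) := by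
  have h := Kernel.partialTraj_compProd_eq_map_traj (X := fun _ => V) (κ := stepKernel K)
    (Nat.zero_le n) (x₀ := fun _ => v)
  have h1 := Kernel.traj_map_frestrictLe_apply (X := fun _ => V) (κ := stepKernel K) 0 n
    (fun _ => v)
  let x : ∀ _ : Finset.Iic n, V := fun i => a i
  have hx : {ω : ℕ → V | ∀ i ≤ n, ω i = a i} = Preorder.frestrictLe (π := fun _ => V) n ⁻¹' {x} := by
    ext ω
    simp [funext_iff, x]
  have hm := congrArg (fun μ => μ ({x} ×ˢ {a (n + 1)})) h
  beta_reduce at hm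
  rw [Measure.map_apply (by fun_prop) ((measurableSet_singleton _).prod (measurableSet_singleton _)),
    Measure.compProd_apply_prod (measurableSet_singleton _) (measurableSet_singleton _),
    lintegral_singleton] at hm
  have hL : {ω : ℕ → V | ∀ i ≤ n + 1, ω i = a i} =
    (fun ω : ℕ → V => (Preorder.frestrictLe (π := fun _ => V) n ω, ω (n + 1))) ⁻¹'
      ({x} ×ˢ {a (n + 1)}) := by
    ext ω
    simp only [Set.mem_ofPred_eq, Set.mem_preimage, Set.mem_prod, Set.mem_singleton_iff]
    have := Set.ext_iff.1 hx ω
    simp only [Set.mem_ofPred_eq, Set.mem_preimage, Set.mem_singleton_iff] at this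
    rw [← this]
    constructor
    · exact fun h => ⟨fun i hi => h i (by omega), h _ le_rfl⟩
    · rintro ⟨h1, h2⟩ i hi
      rcases Nat.lt_or_ge i (n + 1) with h | h
      · exact h1 i (by omega)
      · obtain rfl : i = n + 1 := by omega
        exact h2
  rw [hL, hx, pathMeasure, ← hm, ← h1, Measure.map_apply (Preorder.measurable_frestrictLe n)
    (measurableSet_singleton _), mul_comm]
  congr 1
  change (K (a n)).toMeasure {a (n + 1)} = _
  rw [PMF.toMeasure_apply_singleton _ _ (measurableSet_singleton _)]

/-- The Markov property at time one. -/
theorem pathMeasure_eq_sum (K : V → PMF V) (v : V) :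
    pathMeasure K v =
      Measure.sum fun u => K v u • (pathMeasure K u).map (consPath v) := by
  classical
  refine measure_ext_of_prefixes fun n a => ?_
  have hsum : ∀ n, Measure.sum (fun u => K v u • (pathMeasure K u).map (consPath v))
      {ω | ∀ i ≤ n, ω i = a i} =
      ∑' u, K v u * pathMeasure K u (consPath v ⁻¹' {ω | ∀ i ≤ n, ω i = a i}) := by
    intro n
    rw [Measure.sum_apply _ (measurableSet_prefix n a)]
    refine tsum_congr fun u => ?_
    rw [Measure.smul_apply, Measure.map_apply (measurable_consPath v) (measurableSet_prefix n a)]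
    rfl
  have hpre : ∀ n, consPath v ⁻¹' {ω | ∀ i ≤ n + 1, ω i = a i} =
      if v = a 0 then {ω : ℕ → V | ∀ i ≤ n, ω i = a (i + 1)} else ∅ := by
    intro n
    split_ifs with hv
    · ext ω
      simp only [Set.mem_preimage, Set.mem_ofPred_eq]
      constructor
      · intro h i hi
        exact h (i + 1) (by omega)
      · rintro h (_ | i) hi
        · exact hv
        · exact h i (by omega)
    · ext ω
      simp only [Set.mem_preimage, Set.mem_ofPred_eq, Set.mem_empty_iff_false, iff_false]
      exact fun h => hv (h 0 (by omega))
  induction n with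
  | zero =>
    rw [hsum, pathMeasure_prefix_zero]
    by_cases hv : v = a 0
    · have : consPath v ⁻¹' {ω | ∀ i ≤ 0, ω i = a i} = Set.univ := by
        ext ω; simpa [consPath] using hv
      simp only [this]
      simp [hv, PMF.tsum_coe]
    · have : consPath v ⁻¹' {ω | ∀ i ≤ 0, ω i = a i} = ∅ := by
        ext ω; simpa [consPath] using hv
      simp only [this]
      simp [Ne.symm hv]
  | succ n ih =>
    rw [pathMeasure_prefix_succ, ih, hsum, hsum]
    -- `hpre` strips the first state from a prefix that extends beyond time zero. A prefix ending at
    -- time zero constrains only `v` and is treated separately.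
    cases n with
    | zero =>
      rw [hpre]
      have : consPath v ⁻¹' {ω | ∀ i ≤ 0, ω i = a i} =
          if v = a 0 then Set.univ else ∅ := by
        ext ω; split_ifs with h <;> simp [consPath, h]
      rw [this]
      split_ifs with h
      · simp only [pathMeasure_prefix_zero K _ fun i => a (i + 1)]
        simp only [measure_univ, mul_one, PMF.tsum_coe, one_mul]
        rw [tsum_eq_single (a (0 + 1))]
        · simp [h]
        · intro u hu
          simp [Ne.symm hu]
      · simp
    | succ n =>
      rw [hpre, hpre]
      split_ifs with h
      · rw [← ENNReal.tsum_mul_right]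
        refine tsum_congr fun u => ?_
        rw [pathMeasure_prefix_succ K u (fun i => a (i + 1)), mul_assoc]
      · simp

end Measure

/-- Measurability for the product of the discrete σ-algebras. -/
def MeasurablePaths {V : Type*} (E : Set (ℕ → V)) : Prop :=
  letI : MeasurableSpace V := ⊤
  MeasurableSet E

/-! ### Event probabilities and reachability in finite chains -/

section Chain

variable {V : Type*}

theorem measurablePaths_coord (n : ℕ) (T : Set V) : MeasurablePaths {ω : ℕ → V | ω n ∈ T} := by
  let _ : MeasurableSpace V := ⊤
  exact measurable_pi_apply n (MeasurableSpace.measurableSet_top (s := T))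

theorem MeasurablePaths.iUnion {ι : Type*} [Countable ι] {E : ι → Set (ℕ → V)}
    (h : ∀ i, MeasurablePaths (E i)) : MeasurablePaths (⋃ i, E i) := by
  let _ : MeasurableSpace V := ⊤
  exact MeasurableSet.iUnion h

theorem MeasurablePaths.iInter {ι : Type*} [Countable ι] {E : ι → Set (ℕ → V)}
    (h : ∀ i, MeasurablePaths (E i)) : MeasurablePaths (⋂ i, E i) := by
  let _ : MeasurableSpace V := ⊤
  exact MeasurableSet.iInter h

theorem MeasurablePaths.compl {E : Set (ℕ → V)} (h : MeasurablePaths E) :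
    MeasurablePaths Eᶜ := by
  let _ : MeasurableSpace V := ⊤
  exact MeasurableSet.compl h

/-- The sequences visiting `T`. -/
def eventually (T : Set V) : Set (ℕ → V) := {ω | ∃ n, ω n ∈ T}

/-- The sequences staying in `T`. -/
def always (T : Set V) : Set (ℕ → V) := {ω | ∀ n, ω n ∈ T}

theorem measurablePaths_eventually (T : Set V) : MeasurablePaths (eventually T) := by
  have : eventually T = ⋃ n, {ω | ω n ∈ T} := by ext; simp [eventually]
  rw [this]
  exact .iUnion fun n => measurablePaths_coord n T

theorem measurablePaths_always (T : Set V) : MeasurablePaths (always T) := by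
  have : always T = ⋂ n, {ω | ω n ∈ T} := by ext; simp [always]
  rw [this]
  exact .iInter fun n => measurablePaths_coord n T

theorem measurablePaths_shift (n : ℕ) {E : Set (ℕ → V)} (h : MeasurablePaths E) :
    MeasurablePaths {ω : ℕ → V | (fun k => ω (n + k)) ∈ E} := by
  let _ : MeasurableSpace V := ⊤
  have : Measurable fun (ω : ℕ → V) k => ω (n + k) :=
    measurable_pi_lambda _ fun k => measurable_pi_apply _
  exact this h

variable [Fintype V] (K : V → PMF V)

theorem pathProb_nonneg (v : V) (E : Set (ℕ → V)) : 0 ≤ pathProb K v E := measureReal_nonneg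

theorem pathProb_le_one (v : V) (E : Set (ℕ → V)) : pathProb K v E ≤ 1 :=
  let _ : MeasurableSpace V := ⊤
  measureReal_le_one

theorem pathProb_univ (v : V) : pathProb K v Set.univ = 1 := by
  let _ : MeasurableSpace V := ⊤
  exact probReal_univ

theorem pathProb_empty (v : V) : pathProb K v ∅ = 0 := by
  let _ : MeasurableSpace V := ⊤
  exact measureReal_empty

theorem pathProb_mono (v : V) {E E' : Set (ℕ → V)} (h : E ⊆ E') :
    pathProb K v E ≤ pathProb K v E' :=
  let _ : MeasurableSpace V := ⊤
  measureReal_mono h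

theorem pathProb_le_of_diff_null (v : V) {E E' : Set (ℕ → V)} (h : pathProb K v (E \ E') = 0) :
    pathProb K v E ≤ pathProb K v E' := by
  let _ : MeasurableSpace V := ⊤
  have h1 : pathProb K v E ≤ pathProb K v (E' ∪ E \ E') :=
    pathProb_mono K v fun ω hω => by by_cases h : ω ∈ E' <;> simp [h, hω]
  have h2 : pathProb K v (E' ∪ E \ E') ≤ pathProb K v E' + pathProb K v (E \ E') :=
    measureReal_union_le _ _
  linarith

theorem pathProb_iUnion_null {ι : Type*} [Countable ι] (v : V) {E : ι → Set (ℕ → V)}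
    (h : ∀ i, pathProb K v (E i) = 0) : pathProb K v (⋃ i, E i) = 0 := by
  let _ : MeasurableSpace V := ⊤
  refine (measureReal_eq_zero_iff).2 (measure_iUnion_null fun i => ?_)
  exact (measureReal_eq_zero_iff).1 (h i)

theorem pathProb_subset_null (v : V) {E E' : Set (ℕ → V)} (hE : E ⊆ E')
    (h : pathProb K v E' = 0) : pathProb K v E = 0 :=
  le_antisymm (h ▸ pathProb_mono K v hE) (pathProb_nonneg K v E)

theorem pathProb_iUnion_le {v : V} {E : ℕ → Set (ℕ → V)} (hE : Monotone E) {c : ℝ}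
    (h : ∀ n, pathProb K v (E n) ≤ c) : pathProb K v (⋃ n, E n) ≤ c := by
  let _ : MeasurableSpace V := ⊤
  have ht := tendsto_measure_iUnion_atTop (μ := pathMeasure K v) hE
  have ht' := (ENNReal.tendsto_toReal (measure_ne_top (pathMeasure K v) (⋃ n, E n))).comp ht
  exact le_of_tendsto' ht' h

/-- The average of `F` over the next state. -/
noncomputable def stepAverage (v : V) (F : V → ℝ) : ℝ := ∑ u, (K v u).toReal * F u

theorem sum_toReal (v : V) : ∑ u, (K v u).toReal = 1 := by
  rw [← ENNReal.toReal_sum fun u _ => PMF.apply_ne_top (K v) u, ← tsum_fintype (L := .unconditional _),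
    PMF.tsum_coe, ENNReal.toReal_one]

theorem toReal_pos_iff (v u : V) : 0 < (K v u).toReal ↔ u ∈ (K v).support := by
  rw [ENNReal.toReal_pos_iff, PMF.mem_support_iff, pos_iff_ne_zero]
  exact ⟨fun h => h.1, fun h => ⟨h, (PMF.apply_ne_top (K v) u).lt_top⟩⟩

variable {K} in
theorem stepAverage_mono {v : V} {F G : V → ℝ} (h : ∀ u ∈ (K v).support, F u ≤ G u) :
    stepAverage K v F ≤ stepAverage K v G := by
  refine Finset.sum_le_sum fun u _ => ?_
  by_cases hu : u ∈ (K v).support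
  · exact mul_le_mul_of_nonneg_left (h u hu) ENNReal.toReal_nonneg
  · rw [PMF.mem_support_iff, not_not] at hu
    simp [hu]

variable {K} in
theorem stepAverage_congr {v : V} {F G : V → ℝ} (h : ∀ u ∈ (K v).support, F u = G u) :
    stepAverage K v F = stepAverage K v G :=
  le_antisymm (stepAverage_mono fun u hu => (h u hu).le) (stepAverage_mono fun u hu => (h u hu).ge)

theorem stepAverage_const (v : V) (c : ℝ) : stepAverage K v (fun _ => c) = c := by
  rw [stepAverage, ← Finset.sum_mul, sum_toReal, one_mul]

theorem stepAverage_sub (v : V) (F G : V → ℝ) :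
    stepAverage K v (fun u => F u - G u) = stepAverage K v F - stepAverage K v G := by
  simp [stepAverage, mul_sub]

variable {K} in
/-- If `F` is at most `c` and has average at least `c`, it is equal to `c` at all next states. -/
theorem eq_of_le_stepAverage {v : V} {F : V → ℝ} {c : ℝ} (h : ∀ u ∈ (K v).support, F u ≤ c)
    (hc : c ≤ stepAverage K v F) {u : V} (hu : u ∈ (K v).support) : F u = c := by
  by_contra hne
  have hlt : F u < c := lt_of_le_of_ne (h u hu) hne
  have : stepAverage K v F < ∑ u, (K v u).toReal * c := by
    refine Finset.sum_lt_sum (fun w _ => ?_) ⟨u, Finset.mem_univ _, ?_⟩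
    · by_cases hw : w ∈ (K v).support
      · exact mul_le_mul_of_nonneg_left (h w hw) ENNReal.toReal_nonneg
      · rw [PMF.mem_support_iff, not_not] at hw
        simp [hw]
    · exact mul_lt_mul_of_pos_left hlt ((toReal_pos_iff K v u).2 hu)
  rw [← Finset.sum_mul, sum_toReal, one_mul] at this
  linarith

/-- The Markov property at time one. -/
theorem pathProb_eq_stepAverage (v : V) {E : Set (ℕ → V)} (hE : MeasurablePaths E) :
    pathProb K v E = stepAverage K v fun u => pathProb K u (consPath v ⁻¹' E) := by
  let _ : MeasurableSpace V := ⊤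
  have h := congrArg (fun μ => μ E) (pathMeasure_eq_sum K v)
  beta_reduce at h
  rw [Measure.sum_apply _ hE, tsum_fintype] at h
  simp only [pathProb, stepAverage, Measure.real]
  rw [h, ENNReal.toReal_sum fun u _ => ?_]
  · refine Finset.sum_congr rfl fun u _ => ?_
    rw [Measure.smul_apply, Measure.map_apply (measurable_consPath v) hE, smul_eq_mul,
      ENNReal.toReal_mul]
  · rw [Measure.smul_apply, Measure.map_apply (measurable_consPath v) hE, smul_eq_mul]
    exact ENNReal.mul_ne_top (PMF.apply_ne_top _ _) (measure_ne_top _ _)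

/-- A set of paths that is null for every starting state stays null after a shift. -/
theorem pathProb_shift_null {E : Set (ℕ → V)} (hE : MeasurablePaths E)
    (h : ∀ v, pathProb K v E = 0) (n : ℕ) (v : V) :
    pathProb K v {ω | (fun k => ω (n + k)) ∈ E} = 0 := by
  induction n generalizing v with
  | zero =>
    convert h v using 2
    ext ω
    simp only [Nat.zero_add]
    rfl
  | succ n ih =>
    rw [pathProb_eq_stepAverage K v (measurablePaths_shift _ hE)]
    have : ∀ u, pathProb K u (consPath v ⁻¹' {ω | (fun k => ω (n + 1 + k)) ∈ E}) = 0 := by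
      intro u
      convert ih u using 2
      ext ω
      have : (fun k => consPath v ω (n + 1 + k)) = fun k => ω (n + k) := by
        funext k
        rw [Nat.add_right_comm]
        rfl
      simp only [Set.mem_preimage, Set.mem_ofPred_eq, this]
    simp only [this, stepAverage_const]

/-- The first state of a path is the starting state. -/
theorem pathProb_start (v : V) {E : Set (ℕ → V)} (hE : MeasurablePaths E)
    (h : ∀ ω ∈ E, ω 0 ≠ v) : pathProb K v E = 0 := by
  rw [pathProb_eq_stepAverage K v hE]
  have : consPath v ⁻¹' E = ∅ := Set.eq_empty_of_forall_notMem fun ω hω => h _ hω rfl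
  simp only [this, pathProb_empty, stepAverage_const]

/-- The probability of visiting `T`. -/
noncomputable def reachProb (T : Set V) (v : V) : ℝ := pathProb K v (eventually T)

theorem reachProb_nonneg (T : Set V) (v : V) : 0 ≤ reachProb K T v := pathProb_nonneg K v _

theorem reachProb_le_one (T : Set V) (v : V) : reachProb K T v ≤ 1 := pathProb_le_one K v _

theorem reachProb_mono {T T' : Set V} (h : T ⊆ T') (v : V) : reachProb K T v ≤ reachProb K T' v :=
  pathProb_mono K v fun _ ⟨n, hn⟩ => ⟨n, h hn⟩

theorem reachProb_of_mem {T : Set V} {v : V} (h : v ∈ T) : reachProb K T v = 1 := by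
  rw [reachProb, pathProb_eq_stepAverage K v (measurablePaths_eventually T)]
  have : consPath v ⁻¹' eventually T = Set.univ := Set.eq_univ_of_forall fun ω => ⟨0, h⟩
  simp [this, pathProb_univ, stepAverage_const]

theorem reachProb_of_notMem {T : Set V} {v : V} (h : v ∉ T) :
    reachProb K T v = stepAverage K v (reachProb K T) := by
  rw [reachProb, pathProb_eq_stepAverage K v (measurablePaths_eventually T)]
  refine congrArg _ (funext fun u => congrArg _ (Set.ext fun ω => ⟨?_, ?_⟩))
  · rintro ⟨_ | n, hn⟩
    · exact absurd hn h
    · exact ⟨n, hn⟩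
  · rintro ⟨n, hn⟩
    exact ⟨n + 1, hn⟩

/-- Superharmonicity holds on `T` as well, where the left side is at most one. Reachability
probabilities can thus serve as comparison functions for a different target. -/
theorem stepAverage_reachProb_le (T : Set V) (v : V) :
    stepAverage K v (reachProb K T) ≤ reachProb K T v := by
  by_cases h : v ∈ T
  · rw [reachProb_of_mem K h, ← stepAverage_const K v 1]
    exact stepAverage_mono fun u _ => reachProb_le_one K T u
  · exact (reachProb_of_notMem K h).ge

/-! ### Closed sets, maximum principle, and persistence as reachability -/

/-- `C` is closed under the transitions of the chain. -/
def ClosedUnder (C : Set V) : Prop := ∀ v ∈ C, ∀ u ∈ (K v).support, u ∈ C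

variable {K} in
/-- The probability of visiting `T` is the least nonnegative function that is at least `1` on `T`
and superharmonic off `T`. -/
theorem reachProb_le_of_superharmonic {C T : Set V} {F : V → ℝ} (hC : ClosedUnder K C)
    (h0 : ∀ v ∈ C, 0 ≤ F v) (h1 : ∀ v ∈ C, v ∈ T → 1 ≤ F v)
    (h : ∀ v ∈ C, v ∉ T → stepAverage K v F ≤ F v) {v : V} (hv : v ∈ C) : reachProb K T v ≤ F v := by
  have hmeas : ∀ n, MeasurablePaths {ω : ℕ → V | ∃ k < n, ω k ∈ T} := by
    intro n
    have : {ω : ℕ → V | ∃ k < n, ω k ∈ T} = ⋃ k : Fin n, {ω | ω k ∈ T} := by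
      ext ω
      simp [Fin.exists_iff]
    rw [this]
    exact .iUnion fun k => measurablePaths_coord k T
  have key : ∀ n, ∀ v ∈ C, pathProb K v {ω | ∃ k < n, ω k ∈ T} ≤ F v := by
    intro n
    induction n with
    | zero =>
      intro v hv
      let _ : MeasurableSpace V := ⊤
      simpa [pathProb] using h0 v hv
    | succ n ih =>
      intro v hv
      by_cases hT : v ∈ T
      · exact (pathProb_le_one K v _).trans (h1 v hv hT)
      · rw [pathProb_eq_stepAverage K v (hmeas _)]
        refine le_trans (stepAverage_mono fun u hu => ?_) (h v hv hT)
        refine le_trans (pathProb_mono K u ?_) (ih u (hC v hv u hu))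
        rintro ω ⟨_ | k, hk, hω⟩
        · exact absurd hω hT
        · exact ⟨k, by omega, hω⟩
  have : eventually T = ⋃ n : ℕ, {ω : ℕ → V | ∃ k < n, ω k ∈ T} := by
    ext ω
    simp only [eventually, Set.mem_ofPred_eq, Set.mem_iUnion]
    exact ⟨fun ⟨n, hn⟩ => ⟨n + 1, n, by omega, hn⟩, fun ⟨_, k, _, hk⟩ => ⟨k, hk⟩⟩
  rw [reachProb, this]
  refine pathProb_iUnion_le K (fun m n hmn ω => ?_) fun n => key n v hv
  exact fun ⟨k, hk, hω⟩ => ⟨k, hk.trans_le hmn, hω⟩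

/-- The states from which only states in `D` are reachable. -/
def core (D : Set V) : Set V :=
  {v | ∀ u, Relation.ReflTransGen (fun v u => u ∈ (K v).support) v u → u ∈ D}

theorem core_subset (D : Set V) : core K D ⊆ D := fun v hv => hv v .refl

theorem closedUnder_core (D : Set V) : ClosedUnder K (core K D) :=
  fun _ hv _ hu _ hw => hv _ (.head hu hw)

-- Together with `core_subset` and `closedUnder_core` this makes the core the largest closed subset
-- of `D`.
variable {K} in
theorem subset_core {C D : Set V} (hC : ClosedUnder K C) (hD : C ⊆ D) : C ⊆ core K D := by
  intro v hv u hu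
  refine hD ?_
  induction hu with
  | refl => exact hv
  | tail _ h ih => exact hC _ ih _ h

variable {K} in
/-- A function that is positive somewhere on `C`, nonpositive off `A`, and subharmonic on `A`
attains its maximum over `C` on a nonempty closed subset of `A`. -/
theorem exists_closedUnder_of_subharmonic {A : Set V} {F : V → ℝ} (hA : ∀ v ∉ A, F v ≤ 0)
    (h : ∀ v ∈ A, F v ≤ stepAverage K v F) {v : V} (hv : 0 < F v) :
    ∃ C ⊆ A, ClosedUnder K C ∧ ∃ m, 0 < m ∧ (∀ u, F u ≤ m) ∧ (∀ u, u ∈ C ↔ F u = m) ∧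
      C.Nonempty := by
  have : Nonempty V := ⟨v⟩
  obtain ⟨w, hw⟩ := Finite.exists_max F
  have hpos : 0 < F w := hv.trans_le (hw v)
  have hsub : {u | F u = F w} ⊆ A := by
    intro u hu
    by_contra hA'
    have h1 := hA u hA'
    have h2 : F u = F w := hu
    linarith
  refine ⟨{u | F u = F w}, hsub, ?_, F w, hpos, hw, fun u => Iff.rfl, w, rfl⟩
  intro u hu x hx
  have hu' : F u = F w := hu
  exact eq_of_le_stepAverage (fun y _ => hw y) (hu' ▸ h u (hsub hu)) hx

/-- Almost surely, a path does not stay in `D` without visiting the core of `D`. -/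
theorem pathProb_always_diff_core (D : Set V) (v : V) :
    pathProb K v (always (D \ core K D)) = 0 := by
  by_contra hne
  have hpos : 0 < pathProb K v (always (D \ core K D)) :=
    lt_of_le_of_ne (pathProb_nonneg K v _) (Ne.symm hne)
  -- The probability of staying outside the core but inside `D` is subharmonic there. If positive,
  -- its maximum would be attained on a nonempty closed subset of `D`, which must lie in the core.
  obtain ⟨C, hCA, hC, _, _, _, _, w, hw⟩ := exists_closedUnder_of_subharmonic (K := K)
    (A := D \ core K D) (F := fun v => pathProb K v (always (D \ core K D)))
    (fun u hu => (pathProb_start K u (measurablePaths_always _) fun ω hω h =>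
      hu (h ▸ hω 0)).le)
    (fun u _ => by
      rw [pathProb_eq_stepAverage K u (measurablePaths_always _)]
      exact stepAverage_mono fun x _ => pathProb_mono K x fun ω hω n => hω (n + 1)) hpos
  exact (hCA hw).2 (subset_core hC (hCA.trans Set.sdiff_subset) hw)

/-- Almost surely, only transitions of positive probability are taken. -/
theorem pathProb_transition_null (v : V) :
    pathProb K v {ω | ∃ n, ω (n + 1) ∉ (K (ω n)).support} = 0 := by
  have hm : MeasurablePaths {ω : ℕ → V | ω 1 ∉ (K (ω 0)).support} := by
    let _ : MeasurableSpace V := ⊤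
    have hf : Measurable fun ω : ℕ → V => (ω 0, ω 1) :=
      (measurable_pi_apply 0).prodMk (measurable_pi_apply 1)
    exact hf (Set.Finite.measurableSet (Set.toFinite {p : V × V | p.2 ∉ (K p.1).support}))
  have h0 : ∀ v, pathProb K v {ω : ℕ → V | ω 1 ∉ (K (ω 0)).support} = 0 := by
    intro v
    rw [pathProb_eq_stepAverage K v hm]
    rw [← stepAverage_const K v 0]
    refine stepAverage_congr fun u hu => ?_
    refine pathProb_start K u ?_ fun ω hω h => ?_
    · have : consPath v ⁻¹' {ω : ℕ → V | ω 1 ∉ (K (ω 0)).support} =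
          {ω | ω 0 ∈ (K v).supportᶜ} := rfl
      rw [this]
      exact measurablePaths_coord 0 _
    · have : ω 0 ∉ (K v).support := hω
      exact this (h ▸ hu)
  have := pathProb_iUnion_null K v fun n => pathProb_shift_null K hm h0 n v
  refine pathProb_subset_null K v ?_ this
  rintro ω ⟨n, hn⟩
  exact Set.mem_iUnion.2 ⟨n, hn⟩

/-- The probability that eventually always one of the sets `D i` holds is the probability of
visiting the core of one of them. -/
theorem pathProb_iUnion_eventuallyAlways {ι : Type*} [Countable ι] (D : ι → Set V) (v : V) :
    pathProb K v (⋃ i, eventuallyAlways (D i)) = reachProb K (⋃ i, core K (D i)) v := by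
  refine le_antisymm (pathProb_le_of_diff_null K v ?_) (pathProb_le_of_diff_null K v ?_)
  -- A path that is in `D i` from time `n` on but never visits the core has an `n`-th shift staying
  -- in `D i` minus its core. There are countably many pairs `(i, n)`.
  · have hnull := pathProb_iUnion_null K v fun p : ι × ℕ =>
      pathProb_shift_null K (measurablePaths_always _)
        (pathProb_always_diff_core K (D p.1)) p.2 v
    refine pathProb_subset_null K v ?_ hnull
    rintro ω ⟨hω, hn⟩
    obtain ⟨i, n, hi⟩ := Set.mem_iUnion.1 hω
    refine Set.mem_iUnion.2 ⟨(i, n), fun k => ⟨hi (n + k) (by omega), fun hc => hn ⟨n + k, ?_⟩⟩⟩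
    exact Set.mem_iUnion.2 ⟨i, hc⟩
  · refine pathProb_subset_null K v ?_ (pathProb_transition_null K v)
    rintro ω ⟨⟨n, hn⟩, hω⟩
    by_contra hne
    have hstep : ∀ k, ω (k + 1) ∈ (K (ω k)).support := fun k => by
      by_contra h
      exact hne ⟨k, h⟩
    obtain ⟨i, hi⟩ := Set.mem_iUnion.1 hn
    refine hω (Set.mem_iUnion.2 ⟨i, n, fun m hm => core_subset K (D i) ?_⟩)
    induction m, hm using Nat.le_induction with
    | base => exact hi
    | succ m _ ih => exact closedUnder_core K (D i) _ ih _ (hstep m)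

theorem pathProb_eventuallyAlways (D : Set V) (v : V) :
    pathProb K v (eventuallyAlways D) = reachProb K (core K D) v := by
  simpa [Set.iUnion_const] using pathProb_iUnion_eventuallyAlways K (fun _ : Unit => D) v

end Chain

end PathSpace

/-! ### Policy improvement -/

namespace PathSpace

variable {V : Type*} [Fintype V]

/-- Policy improvement: changing the transition law in a single state so that the average of the
reachability probability increases there improves the reachability probability. -/
theorem reachProb_le_of_improvement {K K' : V → PMF V} {U : Set V} {v₀ : V}
    (hK : ∀ v, v ≠ v₀ → K' v = K v)
    (h : reachProb K U v₀ < stepAverage K' v₀ (reachProb K U)) (v : V) :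
    reachProb K U v ≤ reachProb K' U v := by
  -- Otherwise the loss `reachProb K U - reachProb K' U` has a positive maximum, attained on a
  -- `K'`-closed set `C` disjoint from `U`. The strict gain at `v₀` keeps `v₀` out of `C`, so `C` is
  -- also `K`-closed. From `C` the chain `K` then never reaches `U`, and the loss cannot be
  -- positive.
  by_contra! hlt
  have hsub : ∀ v ∈ Uᶜ, reachProb K U v - reachProb K' U v ≤
      stepAverage K' v fun u => reachProb K U u - reachProb K' U u := by
    intro v hv
    rw [stepAverage_sub, ← reachProb_of_notMem K' hv]
    refine sub_le_sub_right ?_ _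
    by_cases h0 : v = v₀
    · exact h0 ▸ h.le
    · rw [reachProb_of_notMem K hv, stepAverage, stepAverage, hK v h0]
  obtain ⟨C, hCU, hC, m, hm, hle, hmem, w, hw⟩ := exists_closedUnder_of_subharmonic
    (K := K') (A := Uᶜ) (F := fun v => reachProb K U v - reachProb K' U v)
    (fun u hu => by
      rw [Set.notMem_compl_iff] at hu
      simp [reachProb_of_mem _ hu]) hsub (sub_pos.2 hlt)
  have hv₀ : v₀ ∉ C := by
    intro h0
    have h1 : stepAverage K' v₀ (fun u => reachProb K U u - reachProb K' U u) ≤ m := by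
      rw [← stepAverage_const K' v₀ m]
      exact stepAverage_mono fun u _ => hle u
    have h2 := (hmem v₀).1 h0
    rw [stepAverage_sub, ← reachProb_of_notMem K' (hCU h0)] at h1
    linarith
  have hC' : ClosedUnder K C := fun v hv u hu =>
    hC v hv u (by rwa [hK v fun h => hv₀ (h ▸ hv)])
  have h0 : reachProb K U w ≤ 0 := reachProb_le_of_superharmonic (F := fun _ => 0) hC'
    (fun _ _ => le_rfl) (fun u hu hU => absurd hU (hCU hu))
    (fun u _ _ => by rw [stepAverage_const]) hw
  have h1 := (hmem w).1 hw
  have h2 := reachProb_nonneg K' U w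
  linarith

end PathSpace

/-! ### Existence of optimal memoryless strategies -/

namespace MDP

variable {S Act AP : Type*} [Fintype S] (M : MDP S Act AP)

instance [Finite Act] : Finite M.Strategy :=
  inferInstanceAs (Finite {σ : S → Act // ∀ s, (∃ a, M.Enabled s a) → M.Enabled s (σ s)})

instance [Nonempty Act] : Nonempty M.Strategy := by
  classical
  exact ⟨⟨fun s => if h : ∃ a, M.Enabled s a then h.choose else Classical.arbitrary Act,
    fun s h => by
      beta_reduce
      rw [dif_pos h]
      exact h.choose_spec⟩⟩

variable {M}

theorem chain_apply {σ : M.Strategy} {s : S} (h : M.Enabled s (σ.1 s)) (s' : S) :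
    M.chain σ s s' = M.P s (σ.1 s) s' := by
  rw [chain, dif_pos h]
  rfl

theorem chain_congr {σ τ : M.Strategy} {s : S} (h : σ.1 s = τ.1 s) :
    M.chain σ s = M.chain τ s := by
  by_cases hs : M.Enabled s (σ.1 s)
  · have ht : M.Enabled s (τ.1 s) := h ▸ hs
    ext s'
    rw [chain_apply hs, chain_apply ht, h]
  · have ht : ¬ M.Enabled s (τ.1 s) := h ▸ hs
    rw [chain, dif_neg hs, chain, dif_neg ht]

theorem mem_support_chain {σ : M.Strategy} {s : S} (h : M.Enabled s (σ.1 s)) {s' : S} :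
    s' ∈ (M.chain σ s).support ↔ 0 < M.P s (σ.1 s) s' := by
  rw [PMF.mem_support_iff, chain_apply h, ENNReal.coe_ne_zero, pos_iff_ne_zero]

theorem NoDeadlock.enabled (hM : M.NoDeadlock) (σ : M.Strategy) (s : S) :
    M.Enabled s (σ.1 s) := σ.2 s (hM s)

theorem closedUnder_reach (hM : M.NoDeadlock) (σ : M.Strategy) (s : S) :
    ClosedUnder (M.chain σ) (M.Reach s) := fun _ hv _ hu =>
  Relation.ReflTransGen.tail hv ⟨_, (mem_support_chain (hM.enabled σ _)).1 hu⟩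

/-- There is a strategy maximizing the probability of reaching `U` from all states. -/
theorem exists_reachProb_maximal [Finite Act] (hM : M.NoDeadlock) (U : Set S) :
    ∃ σ : M.Strategy, ∀ (τ : M.Strategy) (s : S),
      reachProb (M.chain τ) U s ≤ reachProb (M.chain σ) U s := by
  classical
  rcases isEmpty_or_nonempty M.Strategy with hE | hN
  · have : IsEmpty Act := by
      by_contra h
      rw [not_isEmpty_iff] at h
      exact hE.false (Classical.arbitrary M.Strategy)
    have hS : IsEmpty S := ⟨fun s => (hM s).elim fun a _ => this.false a⟩
    exact (hS.false M.init).elim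
  -- Maximizing the sum over all states makes one strategy a candidate for all starting states at
  -- once: an improvement that hurts no state and helps one would increase the sum.
  obtain ⟨σ, hσ⟩ := Finite.exists_max fun σ : M.Strategy => ∑ s, reachProb (M.chain σ) U s
  have key : ∀ (τ : M.Strategy) (s : S),
      stepAverage (M.chain τ) s (reachProb (M.chain σ) U) ≤ reachProb (M.chain σ) U s := by
    intro τ s₀
    by_contra! hlt
    let σ' : M.Strategy := ⟨fun s => if s = s₀ then τ.1 s else σ.1 s, fun s h => by
      beta_reduce
      split_ifs
      · exact τ.2 s h
      · exact σ.2 s h⟩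
    have h0 : M.chain σ' s₀ = M.chain τ s₀ := chain_congr (if_pos rfl)
    have hlt' : reachProb (M.chain σ) U s₀ <
        stepAverage (M.chain σ') s₀ (reachProb (M.chain σ) U) := by
      rwa [stepAverage, h0]
    have himp := reachProb_le_of_improvement (K := M.chain σ) (K' := M.chain σ')
      (fun s hs => chain_congr (if_neg hs)) hlt'
    have hs₀ : reachProb (M.chain σ) U s₀ < reachProb (M.chain σ') U s₀ :=
      hlt'.trans_le ((stepAverage_mono fun u _ => himp u).trans (stepAverage_reachProb_le _ U s₀))
    exact (Finset.sum_lt_sum (fun s _ => himp s) ⟨s₀, Finset.mem_univ _, hs₀⟩).not_ge (hσ σ')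
  refine ⟨σ, fun τ s => reachProb_le_of_superharmonic (C := Set.univ)
    (fun _ _ _ _ => Set.mem_univ _) (fun s _ => reachProb_nonneg _ U s)
    (fun s _ hs => (reachProb_of_mem _ hs).ge) (fun s _ _ => key τ s) (Set.mem_univ s)⟩

theorem prob_eventuallyAlways (σ : M.Strategy) (s : S) (B : Set S) :
    M.prob σ s (eventuallyAlways B) = reachProb (M.chain σ) (core (M.chain σ) B) s :=
  pathProb_eventuallyAlways _ B s

/-- There is a strategy maximizing the probability of "eventually always `B`" from all states. -/
theorem exists_persistence_maximal [Finite Act] (hM : M.NoDeadlock) (B : Set S) :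
    ∃ σ : M.Strategy, ∀ (τ : M.Strategy) (s : S),
      M.prob τ s (eventuallyAlways B) ≤ M.prob σ s (eventuallyAlways B) := by
  classical
  -- `U` consists of the states from which some strategy stays in `B` along all its transitions.
  -- Persistence of `B` then amounts to reaching `U`.
  let U : Set S := ⋃ τ : M.Strategy, core (M.chain τ) B
  obtain ⟨σ, hσ⟩ := exists_reachProb_maximal hM U
  have hU : ∀ s, ∃ τ : M.Strategy, s ∈ U → s ∈ core (M.chain τ) B := by
    intro s
    by_cases hs : s ∈ U
    · obtain ⟨τ, hτ⟩ := Set.mem_iUnion.1 hs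
      exact ⟨τ, fun _ => hτ⟩
    · exact ⟨σ, fun h => absurd h hs⟩
  choose safe hsafe using hU
  -- Inside `U` each state may use its own safe strategy: a successor lies in the core of that
  -- strategy, hence again in `U`, and may continue with another one.
  let ρ : M.Strategy := ⟨fun s => if s ∈ U then (safe s).1 s else σ.1 s, fun s h => by
    beta_reduce
    split_ifs
    · exact (safe s).2 s h
    · exact σ.2 s h⟩
  have hclosed : ClosedUnder (M.chain ρ) U := by
    intro s hs u hu
    have : M.chain ρ s = M.chain (safe s) s := chain_congr (if_pos hs)
    rw [this] at hu
    exact Set.mem_iUnion.2 ⟨safe s, closedUnder_core _ B s (hsafe s hs) u hu⟩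
  have hUB : U ⊆ B := Set.iUnion_subset fun τ => core_subset _ B
  -- Replacing `σ` inside `U` does not affect the chance of getting there, as the two strategies
  -- agree outside `U`.
  have hρ : ∀ s, reachProb (M.chain σ) U s ≤ reachProb (M.chain ρ) U s := fun s =>
    reachProb_le_of_superharmonic (C := Set.univ) (fun _ _ _ _ => Set.mem_univ _)
      (fun s _ => reachProb_nonneg _ U s) (fun s _ hs => (reachProb_of_mem _ hs).ge)
      (fun s _ hs => by
        have : M.chain ρ s = M.chain σ s := chain_congr (if_neg hs)
        rw [stepAverage, ← this]
        exact stepAverage_reachProb_le _ U s) (Set.mem_univ s)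
  refine ⟨ρ, fun τ s => ?_⟩
  rw [prob_eventuallyAlways, prob_eventuallyAlways]
  calc _ ≤ reachProb (M.chain τ) U s :=
        reachProb_mono _ (Set.subset_iUnion (fun τ : M.Strategy => core (M.chain τ) B) τ) s
    _ ≤ reachProb (M.chain σ) U s := hσ τ s
    _ ≤ reachProb (M.chain ρ) U s := hρ s
    _ ≤ _ := reachProb_mono _ (subset_core hclosed hUB) s

/-- There is a strategy that is a local strategy for `B` at all states. -/
theorem exists_isLocalStrategy [Finite Act] (hM : M.NoDeadlock) (B : Set S) :
    ∃ σ : M.Strategy, ∀ s, M.IsLocalStrategy B s σ := by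
  obtain ⟨σ, hσ⟩ := exists_persistence_maximal hM B
  have : Nonempty M.Strategy := ⟨σ⟩
  exact ⟨σ, fun s => le_antisymm (le_ciSup (f := fun τ => M.prob τ s (eventuallyAlways B))
    (Set.finite_range _).bddAbove σ) (ciSup_le fun τ => hσ τ s)⟩

variable {B R : Set S} {σ : M.Strategy}

theorem persistenceValue_eq_reachProb (h : ∀ s ∈ R, M.IsLocalStrategy B s σ) {s : S}
    (hs : s ∈ R) :
    M.persistenceValue B s = reachProb (M.chain σ) (core (M.chain σ) B) s := by
  rw [← prob_eventuallyAlways, h s hs]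

/-- Following a local strategy does not leave the states of value one. -/
theorem closedUnder_persistenceValue_eq_one (hR : ClosedUnder (M.chain σ) R)
    (h : ∀ s ∈ R, M.IsLocalStrategy B s σ) :
    ClosedUnder (M.chain σ) {s | s ∈ R ∧ M.persistenceValue B s = 1} := by
  rintro s ⟨hs, h1⟩ u hu
  refine ⟨hR s hs u hu, ?_⟩
  rw [persistenceValue_eq_reachProb h (hR s hs u hu)]
  rw [persistenceValue_eq_reachProb h hs] at h1
  -- Outside the core the value one is an average of values at most one, so all successors have
  -- value one.
  by_cases hc : s ∈ core (M.chain σ) B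
  · exact reachProb_of_mem _ (closedUnder_core _ B s hc u hu)
  · rw [reachProb_of_notMem _ hc] at h1
    exact eq_of_le_stepAverage (fun _ _ => reachProb_le_one _ _ _) h1.ge hu

end MDP

/-! ### Transferring averages between chains -/

namespace PathSpace

variable {V V' : Type*} [Fintype V] [Fintype V'] {K : V → PMF V} {L : V' → PMF V'}

theorem stepAverage_of_support {v u : V} (h : ∀ x ∈ (K v).support, x = u) (F : V → ℝ) :
    stepAverage K v F = F u := by
  rw [← stepAverage_const K v (F u)]
  exact stepAverage_congr fun x hx => by rw [h x hx]

theorem stepAverage_of_injective {f : V' → V} (hf : Function.Injective f) {v : V} {v' : V'}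
    (h : ∀ x, K v (f x) = L v' x) (h0 : ∀ u ∉ Set.range f, K v u = 0) (F : V → ℝ) :
    stepAverage K v F = stepAverage L v' fun x => F (f x) := by
  refine (Fintype.sum_of_injective f hf _ _ (fun u hu => ?_) fun x => ?_).symm
  · simp [h0 u hu]
  · rw [h x]

end PathSpace

namespace MDP

variable {S Act AP : Type*} [Fintype S] {M : MDP S Act AP}

theorem enabled_of_pos {s s' : S} {a : Act} (h : 0 < M.P s a s') : M.Enabled s a := by
  refine (M.sum_P s a).resolve_left fun h0 => h.ne' ?_
  exact (Finset.sum_eq_zero_iff.1 h0) s' (Finset.mem_univ _)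

theorem Enabled.exists_pos {s : S} {a : Act} (h : M.Enabled s a) : ∃ s', 0 < M.P s a s' := by
  by_contra! h0
  have : ∑ s', M.P s a s' = 0 := Finset.sum_eq_zero fun s' _ => le_antisymm (h0 s') zero_le
  exact zero_ne_one (this.symm.trans h)

/-- A strategy chooses some transition in a state that has one. -/
theorem exists_strategy_pos (σ : M.Strategy) {s s' : S} {a : Act} (h : 0 < M.P s a s') :
    ∃ s', 0 < M.P s (σ.1 s) s' :=
  Enabled.exists_pos (σ.2 s ⟨a, enabled_of_pos h⟩)

end MDP

/-! ### Contexts, satisfied objectives and active pairs -/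

section Requirement

variable {S Act AP Q W : Type*} [Fintype S] {M : MDP S Act AP} {A : CAPTL S Q W}

theorem CAPTL.mem_contexts {q q' : Q} {w : W} (h : A.next q w = some q') : w ∈ A.contexts q :=
  ⟨q', h⟩

theorem satContext_iff (hA : A.IsPersistence) {q : Q} {w : W} (hw : w ∈ A.contexts q) (s : S) :
    SatContext M A s w ↔ M.persistenceValue (A.objSet q) s ∈ A.ctxInt w := by
  rw [SatContext, hA.ctxSet_eq q w hw]

theorem SatContext.eq (hA : A.IsPersistence) {q : Q} {w w' : W} (hw : w ∈ A.contexts q)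
    (hw' : w' ∈ A.contexts q) {s : S} (h : SatContext M A s w) (h' : SatContext M A s w') :
    w = w' := by
  by_contra hne
  exact Set.disjoint_left.1 (hA.disjoint q hw hw' hne) ((satContext_iff hA hw s).1 h)
    ((satContext_iff hA hw' s).1 h')

/-- All intervals of `q` lie in `[0, c)` with `c ≤ 1`, which excludes the value one. A protocol
therefore never abandons a satisfied objective. -/
theorem SatObjective.not_satContext (hA : A.IsPersistence) {q : Q} {w : W} {s : S}
    (h : SatObjective M A s q) (hw : w ∈ A.contexts q) : ¬ SatContext M A s w := by
  intro hs
  obtain ⟨c, _, hc, hU⟩ := hA.union q ⟨w, hw⟩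
  have hmem : M.persistenceValue (A.objSet q) s ∈ ⋃ w ∈ A.contexts q, A.ctxInt w :=
    Set.mem_biUnion hw ((satContext_iff hA hw s).1 hs)
  rw [hU, show M.persistenceValue (A.objSet q) s = 1 from h] at hmem
  exact absurd hmem.2 (not_lt.2 hc)

/-- Local optimality is assumed only at reachable states; this makes it available at all active
pairs. -/
theorem Active.mem_reach {σ : Q → M.Strategy} {q : Q} {s : S} (h : Active M A σ q s) :
    s ∈ M.Reach M.init := by
  induction h with
  | init => exact .refl
  | move _ _ hp ih => exact Relation.ReflTransGen.tail ih ⟨_, hp⟩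
  | switch _ _ _ ih => exact ih

theorem notMem_switchingSet {σ : Q → M.Strategy} {q : Q} {s : S} (h : Active M A σ q s) :
    s ∉ switchingSet M A σ q ↔ ∀ w ∈ A.contexts q, ¬ SatContext M A s w := by
  constructor
  · exact fun hn w hw hs => hn ⟨h, w, hw, hs⟩
  · rintro hn ⟨_, w, hw, hs⟩
    exact hn w hw hs

/-- A strategy profile induces at most one protocol. -/
theorem IsInducedProtocol.eq {σ : Q → M.Strategy} {Pr Pr' : Protocol S Act Q W}
    (h : IsInducedProtocol M A σ Pr) (h' : IsInducedProtocol M A σ Pr') : Pr = Pr' := by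
  funext q s
  refine Option.ext fun x => ?_
  rcases x with a | w
  · exact (h.1 q s a).trans (h'.1 q s a).symm
  · exact (h.2 q s w).trans (h'.2 q s w).symm

end Requirement

/-! ### The chain of the composition with a protocol -/

section ProtocolChain

variable {S Act AP Q W : Type*} [Fintype S] [Fintype Q] {M : MDP S Act AP} {A : CAPTL S Q W}
  {σ : Q → M.Strategy} {Pr : Protocol S Act Q W}

theorem protocolP_pos_iff {q q' : Q} {s s' : S} {α : Act ⊕ W} :
    0 < protocolP M A Pr (q, s) α (q', s') ↔ Pr q s = some α ∧
      ((∃ a, α = Sum.inl a ∧ q' = q ∧ 0 < M.P s a s') ∨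
        ∃ w, α = Sum.inr w ∧ s' = s ∧ A.next q w = some q') := by
  rcases α with a | w
  · by_cases h : Pr q s = some (Sum.inl a) ∧ q' = q
    · simp [protocolP, h]
    · simp only [protocolP, if_neg h]
      simp only [lt_self_iff_false, Sum.inl.injEq, reduceCtorEq, false_and, exists_false,
        or_false, false_iff]
      rintro ⟨h1, a', rfl, h2, _⟩
      exact h ⟨h1, h2⟩
  · by_cases h : Pr q s = some (Sum.inr w) ∧ s' = s ∧ A.next q w = some q'
    · simp [protocolP, h]
    · simp only [protocolP, if_neg h]
      simp only [lt_self_iff_false, Sum.inr.injEq, reduceCtorEq, false_and, exists_false,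
        false_or, false_iff]
      rintro ⟨h1, w', rfl, h2⟩
      exact h ⟨h1, h2⟩

/-- In a state where the protocol is defined and offers a transition, its choice is followed. -/
theorem protocolMDP_strategy_eq (κ : (protocolMDP M A Pr).Strategy) {q q' : Q} {s s' : S}
    {α : Act ⊕ W} (h : 0 < protocolP M A Pr (q, s) α (q', s')) : κ.1 (q, s) = α := by
  obtain ⟨⟨q'', s''⟩, h'⟩ := MDP.exists_strategy_pos (M := protocolMDP M A Pr) κ h
  have h1 := (protocolP_pos_iff.1 h).1
  have h2 := (protocolP_pos_iff.1 h').1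
  exact Option.some_injective _ (h2.symm.trans h1)

theorem protocolMDP_support_switch (hPr : IsInducedProtocol M A σ Pr)
    (κ : (protocolMDP M A Pr).Strategy) {q q' : Q} {s : S} {w : W} (hact : Active M A σ q s)
    (hw : A.next q w = some q') (hs : SatContext M A s w) {u : Q × S}
    (hu : u ∈ ((protocolMDP M A Pr).chain κ (q, s)).support) : u = (q', s) := by
  have hp : Pr q s = some (Sum.inr w) := (hPr.2 q s w).2 ⟨hact, CAPTL.mem_contexts hw, hs⟩
  have hpos : 0 < protocolP M A Pr (q, s) (Sum.inr w) (q', s) :=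
    protocolP_pos_iff.2 ⟨hp, Or.inr ⟨w, rfl, rfl, hw⟩⟩
  have hκ := protocolMDP_strategy_eq κ hpos
  have hen : (protocolMDP M A Pr).Enabled (q, s) (κ.1 (q, s)) := hκ ▸ MDP.enabled_of_pos hpos
  have h := (MDP.mem_support_chain hen).1 hu
  rw [hκ] at h
  obtain ⟨q'', s''⟩ := u
  obtain ⟨_, ⟨a, ha, _⟩ | ⟨w', hw', rfl, h2⟩⟩ := protocolP_pos_iff.1 h
  · cases ha
  · cases hw'
    rw [hw] at h2
    rw [Option.some_injective _ h2]

/-- The protocol offers a single action here, so whatever `κ` is, the layer of `q` carries a copy of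
the chain of `σ q`. -/
theorem protocolMDP_chain_move (hM : M.NoDeadlock) (hPr : IsInducedProtocol M A σ Pr)
    (κ : (protocolMDP M A Pr).Strategy) {q : Q} {s : S} (hact : Active M A σ q s)
    (hs : ∀ w ∈ A.contexts q, ¬ SatContext M A s w) :
    (∀ s', (protocolMDP M A Pr).chain κ (q, s) (q, s') = M.chain (σ q) s s') ∧
      ∀ u ∉ Set.range (fun s' => (q, s')), (protocolMDP M A Pr).chain κ (q, s) u = 0 := by
  have hp : Pr q s = some (Sum.inl ((σ q).1 s)) :=
    (hPr.1 q s _).2 ⟨hact, (notMem_switchingSet hact).2 hs, rfl⟩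
  obtain ⟨t, ht⟩ := (hM.enabled (σ q) s).exists_pos
  have hpos : 0 < protocolP M A Pr (q, s) (Sum.inl ((σ q).1 s)) (q, t) :=
    protocolP_pos_iff.2 ⟨hp, Or.inl ⟨_, rfl, rfl, ht⟩⟩
  have hκ := protocolMDP_strategy_eq κ hpos
  have hen : (protocolMDP M A Pr).Enabled (q, s) (κ.1 (q, s)) := hκ ▸ MDP.enabled_of_pos hpos
  refine ⟨fun s' => ?_, fun u hu => ?_⟩
  · rw [MDP.chain_apply hen, MDP.chain_apply (hM.enabled _ _), hκ]
    simp [protocolMDP, protocolP, hp]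
  · rw [MDP.chain_apply hen, hκ]
    obtain ⟨q', s'⟩ := u
    have hq : q' ≠ q := by
      rintro rfl
      exact hu ⟨s', rfl⟩
    simp [protocolMDP, protocolP, hq]

/-- The pairs at which the protocol is undefined, and the chain halts by convention, are thus
irrelevant. -/
theorem closedUnder_active (hM : M.NoDeadlock) (hPr : IsInducedProtocol M A σ Pr)
    (κ : (protocolMDP M A Pr).Strategy) :
    ClosedUnder ((protocolMDP M A Pr).chain κ) {v | Active M A σ v.1 v.2} := by
  rintro ⟨q, s⟩ hact u hu
  by_cases h : ∃ w ∈ A.contexts q, SatContext M A s w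
  · obtain ⟨w, ⟨q', hw⟩, hs⟩ := h
    rw [protocolMDP_support_switch hPr κ hact hw hs hu]
    exact Active.switch hact hw hs
  · push Not at h
    obtain ⟨h1, h2⟩ := protocolMDP_chain_move hM hPr κ hact h
    by_cases hr : u ∈ Set.range (fun s' => (q, s'))
    · obtain ⟨s', rfl⟩ := hr
      refine Active.move hact h ((MDP.mem_support_chain (hM.enabled _ _)).1 ?_)
      rwa [PMF.mem_support_iff, ← h1, ← PMF.mem_support_iff]
    · exact absurd (h2 u hr) ((PMF.mem_support_iff _ _).1 hu)

end ProtocolChain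

/-! ### The composed model has no real choices -/

section CompositionChain

variable {S Act AP Q W : Type*} [Fintype S] {M : MDP S Act AP} {A : CAPTL S Q W}
  {part : Q → Q → Set S} {strat : Q → Option M.Strategy} {σ : Q → M.Strategy} {seen : Set Q}

theorem compP_requirement_pos_iff {q : Q} {s : S} {α : CompAct Act W} {v : S × Q × Turn} :
    0 < compP M A part strat (s, q, Turn.requirement) α v ↔
      (∃ w q', α = CompAct.ctx w ∧ A.next q w = some q' ∧ s ∈ part q q' ∧
        v = (s, q', Turn.requirement)) ∨
      (α = CompAct.tau ∧ s ∈ part q q ∧ v = (s, q, Turn.system)) := by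
  obtain ⟨s', q', _ | _⟩ := v <;> rcases α with a | w | _
  · simp [compP]
  · simp [compP]
  · by_cases h : s' = s ∧ q' = q ∧ s ∈ part q q
    · simp [compP, h]
    · simp only [compP, if_neg h]
      simp only [lt_self_iff_false, Prod.mk.injEq, reduceCtorEq, and_false,
        exists_false, false_or, true_and, and_true, false_iff]
      rintro ⟨h1, rfl, rfl⟩
      exact h ⟨rfl, rfl, h1⟩
  · simp [compP]
  · by_cases h : s' = s ∧ A.next q w = some q' ∧ s ∈ part q q'
    · obtain ⟨rfl, h2, h3⟩ := h
      simp [compP, h2, h3]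
    · simp only [compP, if_neg h]
      simp only [lt_self_iff_false, Prod.mk.injEq, reduceCtorEq, and_false,
        or_false, and_true, false_iff]
      rintro ⟨w', q'', hw, h1, h2, rfl, rfl⟩
      cases hw
      exact h ⟨rfl, h1, h2⟩
  · simp [compP]

theorem compP_system_pos_iff {q : Q} {s : S} {α : CompAct Act W} {v : S × Q × Turn} :
    0 < compP M A part strat (s, q, Turn.system) α v ↔
      ∃ τ s', strat q = some τ ∧ α = CompAct.act (τ.1 s) ∧ 0 < M.P s (τ.1 s) s' ∧
        v = (s', q, Turn.requirement) := by
  obtain ⟨s', q', _ | _⟩ := v <;> rcases α with a | w | _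
  · simp [compP]
  · simp [compP]
  · simp [compP]
  · by_cases h : q' = q ∧ ∃ σ, strat q = some σ ∧ σ.1 s = a
    · obtain ⟨rfl, σ, h1, rfl⟩ := h
      simp [compP, h1]
    · simp only [compP, if_neg h]
      simp only [lt_self_iff_false, false_iff]
      rintro ⟨τ, s'', h1, h2, _, h3⟩
      cases h2
      cases h3
      exact h ⟨rfl, τ, h1, rfl⟩
  · simp [compP]
  · simp [compP]

/-- The family `part` of sets of states and the partial strategy profile `strat` are those that
belong to the strategy profile `σ`, at all objectives in `seen`; and `seen` contains all
objectives that can become active. -/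
structure Realizes (M : MDP S Act AP) (A : CAPTL S Q W) (σ : Q → M.Strategy)
    (part : Q → Q → Set S) (strat : Q → Option M.Strategy) (seen : Set Q) : Prop where
  init_mem : A.init ∈ seen
  strat_eq : ∀ q ∈ seen, strat q = some (σ q)
  mem_part : ∀ q ∈ seen, ∀ w q', A.next q w = some q' →
    ∀ s, s ∈ part q q' ↔ s ∈ M.Reach M.init ∧ SatContext M A s w
  mem_part_self : ∀ q ∈ seen, ∀ s, s ∈ part q q ↔
    s ∈ M.Reach M.init ∧ ∀ w ∈ A.contexts q, ¬ SatContext M A s w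
  next_mem : ∀ q ∈ seen, ∀ w q', A.next q w = some q' → (part q q').Nonempty → q' ∈ seen

theorem Realizes.active_mem_seen (h : Realizes M A σ part strat seen) {q : Q} {s : S}
    (hact : Active M A σ q s) : q ∈ seen := by
  induction hact with
  | init => exact h.init_mem
  | move _ _ _ ih => exact ih
  | switch hact hw hs ih =>
    exact h.next_mem _ ih _ _ hw ⟨_, (h.mem_part _ ih _ _ hw _).2 ⟨hact.mem_reach, hs⟩⟩

/-- The states of the composed model that occur when the profile `σ` is followed. -/
def liveStates (M : MDP S Act AP) (A : CAPTL S Q W) (σ : Q → M.Strategy) : Set (S × Q × Turn) :=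
  {v | Active M A σ v.2.1 v.1 ∧
    (v.2.2 = Turn.system → ∀ w ∈ A.contexts v.2.1, ¬ SatContext M A v.1 w)}

variable [Fintype Q]

/-- Disjoint intervals rule out a second context and `s ∉ R_q^q` disables the stutter action. Only
`w` has a successor, and a strategy must choose an enabled action. -/
theorem compMDP_switch (hA : A.IsPersistence) (h : Realizes M A σ part strat seen)
    (ρ : (compMDP M A part strat).Strategy) {q q' : Q} {s : S} {w : W}
    (hact : Active M A σ q s) (hw : A.next q w = some q') (hs : SatContext M A s w) :
    ρ.1 (s, q, Turn.requirement) = CompAct.ctx w ∧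
      ∀ v, 0 < compP M A part strat (s, q, Turn.requirement) (ρ.1 (s, q, Turn.requirement)) v ↔
        v = (s, q', Turn.requirement) := by
  have hq := h.active_mem_seen hact
  have hpos : ∀ α v, 0 < compP M A part strat (s, q, Turn.requirement) α v ↔
      α = CompAct.ctx w ∧ v = (s, q', Turn.requirement) := by
    intro α v
    rw [compP_requirement_pos_iff]
    constructor
    · rintro (⟨w', q'', rfl, hw', hp, rfl⟩ | ⟨_, hp, _⟩)
      · have hs' := ((h.mem_part q hq w' q'' hw' s).1 hp).2
        obtain rfl := hs.eq hA (CAPTL.mem_contexts hw) (CAPTL.mem_contexts hw') hs'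
        rw [hw] at hw'
        rw [Option.some_injective _ hw']
        exact ⟨rfl, rfl⟩
      · exact absurd hs (((h.mem_part_self q hq s).1 hp).2 w (CAPTL.mem_contexts hw))
    · rintro ⟨rfl, rfl⟩
      exact Or.inl ⟨w, q', rfl, hw, (h.mem_part q hq w q' hw s).2 ⟨hact.mem_reach, hs⟩, rfl⟩
  obtain ⟨v, hv⟩ := MDP.exists_strategy_pos (M := compMDP M A part strat) ρ
    ((hpos (CompAct.ctx w) (s, q', Turn.requirement)).2 ⟨rfl, rfl⟩)
  have hρ := ((hpos _ _).1 hv).1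
  exact ⟨hρ, fun v => by rw [hpos, hρ]; simp⟩

theorem compMDP_stay (h : Realizes M A σ part strat seen)
    (ρ : (compMDP M A part strat).Strategy) {q : Q} {s : S}
    (hact : Active M A σ q s) (hs : ∀ w ∈ A.contexts q, ¬ SatContext M A s w) :
    ρ.1 (s, q, Turn.requirement) = CompAct.tau ∧
      ∀ v, 0 < compP M A part strat (s, q, Turn.requirement) (ρ.1 (s, q, Turn.requirement)) v ↔
        v = (s, q, Turn.system) := by
  have hq := h.active_mem_seen hact
  have hpos : ∀ α v, 0 < compP M A part strat (s, q, Turn.requirement) α v ↔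
      α = CompAct.tau ∧ v = (s, q, Turn.system) := by
    intro α v
    rw [compP_requirement_pos_iff]
    constructor
    · rintro (⟨w', q'', rfl, hw', hp, rfl⟩ | ⟨h1, _, h2⟩)
      · exact absurd ((h.mem_part q hq w' q'' hw' s).1 hp).2 (hs w' (CAPTL.mem_contexts hw'))
      · exact ⟨h1, h2⟩
    · rintro ⟨rfl, rfl⟩
      exact Or.inr ⟨rfl, (h.mem_part_self q hq s).2 ⟨hact.mem_reach, hs⟩, rfl⟩
  obtain ⟨v, hv⟩ := MDP.exists_strategy_pos (M := compMDP M A part strat) ρ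
    ((hpos CompAct.tau (s, q, Turn.system)).2 ⟨rfl, rfl⟩)
  have hρ := ((hpos _ _).1 hv).1
  exact ⟨hρ, fun v => by rw [hpos, hρ]; simp⟩

theorem compMDP_move (hM : M.NoDeadlock) (h : Realizes M A σ part strat seen)
    (ρ : (compMDP M A part strat).Strategy) {q : Q} {s : S} (hact : Active M A σ q s) :
    ρ.1 (s, q, Turn.system) = CompAct.act ((σ q).1 s) ∧
      ∀ v, 0 < compP M A part strat (s, q, Turn.system) (ρ.1 (s, q, Turn.system)) v ↔
        ∃ s', 0 < M.P s ((σ q).1 s) s' ∧ v = (s', q, Turn.requirement) := by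
  have hq := h.strat_eq q (h.active_mem_seen hact)
  have hpos : ∀ α v, 0 < compP M A part strat (s, q, Turn.system) α v ↔
      α = CompAct.act ((σ q).1 s) ∧
        ∃ s', 0 < M.P s ((σ q).1 s) s' ∧ v = (s', q, Turn.requirement) := by
    intro α v
    rw [compP_system_pos_iff, hq]
    constructor
    · rintro ⟨τ, s', hτ, h1, h2, h3⟩
      cases hτ
      exact ⟨h1, s', h2, h3⟩
    · rintro ⟨h1, s', h2, h3⟩
      exact ⟨σ q, s', rfl, h1, h2, h3⟩
  obtain ⟨t, ht⟩ := (hM.enabled (σ q) s).exists_pos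
  obtain ⟨v, hv⟩ := MDP.exists_strategy_pos (M := compMDP M A part strat) ρ
    ((hpos (CompAct.act ((σ q).1 s)) (t, q, Turn.requirement)).2 ⟨rfl, t, ht, rfl⟩)
  have hρ := ((hpos _ _).1 hv).1
  exact ⟨hρ, fun v => by rw [hpos, hρ]; simp⟩

theorem mem_liveStates_of_pos (hM : M.NoDeadlock) (hA : A.IsPersistence)
    (h : Realizes M A σ part strat seen) (ρ : (compMDP M A part strat).Strategy)
    {v u : S × Q × Turn} (hv : v ∈ liveStates M A σ)
    (hu : 0 < compP M A part strat v (ρ.1 v) u) : u ∈ liveStates M A σ := by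
  obtain ⟨s, q, t⟩ := v
  obtain ⟨hact, hsys⟩ := hv
  cases t with
  | system =>
    obtain ⟨s', hs', rfl⟩ := ((compMDP_move hM h ρ hact).2 u).1 hu
    exact ⟨Active.move hact (hsys rfl) hs', by simp⟩
  | requirement =>
    by_cases hs : ∃ w ∈ A.contexts q, SatContext M A s w
    · obtain ⟨w, ⟨q', hw⟩, hs⟩ := hs
      obtain rfl := ((compMDP_switch hA h ρ hact hw hs).2 u).1 hu
      exact ⟨Active.switch hact hw hs, by simp⟩
    · push Not at hs
      obtain rfl := ((compMDP_stay h ρ hact hs).2 u).1 hu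
      exact ⟨hact, fun _ => hs⟩

/-- The pairs of the requirement-turn states that are reachable in the composed model are the
active pairs. -/
theorem mem_reachUnder_iff_active (hM : M.NoDeadlock) (hA : A.IsPersistence)
    (h : Realizes M A σ part strat seen) (ρ : (compMDP M A part strat).Strategy) {q : Q} {s : S} :
    (s, q, Turn.requirement) ∈ (compMDP M A part strat).ReachUnder ρ
      (compMDP M A part strat).init ↔ Active M A σ q s := by
  constructor
  · intro hr
    suffices ∀ v ∈ (compMDP M A part strat).ReachUnder ρ (compMDP M A part strat).init,
        v ∈ liveStates M A σ from (this _ hr).1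
    intro v hv
    induction hv with
    | refl => exact ⟨Active.init, fun ht => by cases ht⟩
    | tail _ hstep ih => exact mem_liveStates_of_pos hM hA h ρ ih hstep
  · intro hact
    induction hact with
    | init => exact .refl
    | move hact hs hp ih =>
      -- One move of an active pair is a stutter step followed by a system step.
      refine Relation.ReflTransGen.tail (Relation.ReflTransGen.tail ih
        (((compMDP_stay h ρ hact hs).2 _).2 rfl)) ?_
      exact ((compMDP_move hM h ρ hact).2 _).2 ⟨_, hp, rfl⟩
    | switch hact hw hs ih =>
      exact Relation.ReflTransGen.tail ih (((compMDP_switch hA h ρ hact hw hs).2 _).2 rfl)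

/-- The protocol read off from any strategy of the composed model is induced by the profile. -/
theorem isInducedProtocol_readProtocol (hM : M.NoDeadlock) (hA : A.IsPersistence)
    (h : Realizes M A σ part strat seen) (ρ : (compMDP M A part strat).Strategy) :
    IsInducedProtocol M A σ (readProtocol (compMDP M A part strat) ρ) := by
  have hdef : ∀ q s, ¬ Active M A σ q s →
      readProtocol (compMDP M A part strat) ρ q s = none := fun q s hact =>
    if_neg fun hr => hact ((mem_reachUnder_iff_active hM hA h ρ).1 hr)
  have hswitch : ∀ q s w, Active M A σ q s → w ∈ A.contexts q → SatContext M A s w →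
      readProtocol (compMDP M A part strat) ρ q s = some (Sum.inr w) := by
    rintro q s w hact ⟨q', hw⟩ hs
    rw [readProtocol, if_pos ((mem_reachUnder_iff_active hM hA h ρ).2 hact),
      (compMDP_switch hA h ρ hact hw hs).1]
  have hstay : ∀ q s, Active M A σ q s → (∀ w ∈ A.contexts q, ¬ SatContext M A s w) →
      readProtocol (compMDP M A part strat) ρ q s = some (Sum.inl ((σ q).1 s)) := by
    intro q s hact hs
    rw [readProtocol, if_pos ((mem_reachUnder_iff_active hM hA h ρ).2 hact),
      (compMDP_stay h ρ hact hs).1, (compMDP_move hM h ρ hact).1]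
  constructor
  · intro q s a
    by_cases hact : Active M A σ q s
    · rw [notMem_switchingSet hact]
      by_cases hs : ∀ w ∈ A.contexts q, ¬ SatContext M A s w
      · rw [hstay q s hact hs]
        simp only [Option.some.injEq, Sum.inl.injEq]
        exact ⟨fun h => ⟨hact, hs, h⟩, fun h => h.2.2⟩
      · have hs' := hs
        push Not at hs'
        obtain ⟨w, hw, hsw⟩ := hs'
        rw [hswitch q s w hact hw hsw]
        simp [hs]
    · simp [hdef q s hact, hact]
  · intro q s w
    by_cases hact : Active M A σ q s
    · by_cases hs : ∀ w ∈ A.contexts q, ¬ SatContext M A s w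
      · rw [hstay q s hact hs]
        simp only [Option.some.injEq, reduceCtorEq, false_iff]
        exact fun h => hs w h.2.1 h.2.2
      · push Not at hs
        obtain ⟨w', hw', hsw'⟩ := hs
        rw [hswitch q s w' hact hw' hsw']
        simp only [Option.some.injEq, Sum.inr.injEq]
        constructor
        · rintro rfl
          exact ⟨hact, hw', hsw'⟩
        · exact fun h => hsw'.eq hA hw' h.2.1 h.2.2
    · simp [hdef q s hact, hact]

/-- Support and positive transitions agree only where the chosen action is enabled, since a chain
idles elsewhere; so each kind of live state is checked to have an enabled choice. -/
theorem closedUnder_liveStates (hM : M.NoDeadlock) (hA : A.IsPersistence)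
    (h : Realizes M A σ part strat seen) (ρ : (compMDP M A part strat).Strategy) :
    ClosedUnder ((compMDP M A part strat).chain ρ) (liveStates M A σ) := by
  intro v hv u hu
  obtain ⟨s, q, t⟩ := v
  have hen : (compMDP M A part strat).Enabled (s, q, t) (ρ.1 (s, q, t)) := by
    cases t with
    | system =>
      obtain ⟨s', hs'⟩ := (hM.enabled (σ q) s).exists_pos
      exact MDP.enabled_of_pos (((compMDP_move hM h ρ hv.1).2 _).2 ⟨s', hs', rfl⟩)
    | requirement =>
      by_cases hs : ∃ w ∈ A.contexts q, SatContext M A s w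
      · obtain ⟨w, ⟨q', hw⟩, hs⟩ := hs
        exact MDP.enabled_of_pos (((compMDP_switch hA h ρ hv.1 hw hs).2 _).2 rfl)
      · push Not at hs
        exact MDP.enabled_of_pos (((compMDP_stay h ρ hv.1 hs).2 _).2 rfl)
  exact mem_liveStates_of_pos hM hA h ρ hv ((MDP.mem_support_chain hen).1 hu)

theorem compMDP_support_switch (hA : A.IsPersistence) (h : Realizes M A σ part strat seen)
    (ρ : (compMDP M A part strat).Strategy) {q q' : Q} {s : S} {w : W}
    (hact : Active M A σ q s) (hw : A.next q w = some q') (hs : SatContext M A s w)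
    (v : S × Q × Turn) :
    v ∈ ((compMDP M A part strat).chain ρ (s, q, Turn.requirement)).support ↔
      v = (s, q', Turn.requirement) := by
  have hc := (compMDP_switch hA h ρ hact hw hs).2
  rw [MDP.mem_support_chain (MDP.enabled_of_pos ((hc _).2 rfl))]
  exact hc v

theorem compMDP_support_stay (h : Realizes M A σ part strat seen)
    (ρ : (compMDP M A part strat).Strategy) {q : Q} {s : S}
    (hact : Active M A σ q s) (hs : ∀ w ∈ A.contexts q, ¬ SatContext M A s w)
    (v : S × Q × Turn) :
    v ∈ ((compMDP M A part strat).chain ρ (s, q, Turn.requirement)).support ↔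
      v = (s, q, Turn.system) := by
  have hc := (compMDP_stay h ρ hact hs).2
  rw [MDP.mem_support_chain (MDP.enabled_of_pos ((hc _).2 rfl))]
  exact hc v

theorem compMDP_chain_move (hM : M.NoDeadlock) (h : Realizes M A σ part strat seen)
    (ρ : (compMDP M A part strat).Strategy) {q : Q} {s : S} (hact : Active M A σ q s) :
    (∀ s', (compMDP M A part strat).chain ρ (s, q, Turn.system) (s', q, Turn.requirement) =
      M.chain (σ q) s s') ∧
    ∀ u ∉ Set.range (fun s' => (s', q, Turn.requirement)),
      (compMDP M A part strat).chain ρ (s, q, Turn.system) u = 0 := by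
  obtain ⟨hρ, hc⟩ := compMDP_move hM h ρ hact
  obtain ⟨t, ht⟩ := (hM.enabled (σ q) s).exists_pos
  have hen : (compMDP M A part strat).Enabled (s, q, Turn.system) (ρ.1 (s, q, Turn.system)) :=
    MDP.enabled_of_pos ((hc _).2 ⟨t, ht, rfl⟩)
  refine ⟨fun s' => ?_, fun u hu => ?_⟩
  · rw [MDP.chain_apply hen, MDP.chain_apply (hM.enabled _ _), hρ]
    simp [compMDP, compP, h.strat_eq q (h.active_mem_seen hact)]
  · by_contra hne
    obtain ⟨s', _, rfl⟩ := (hc u).1 ((MDP.mem_support_chain hen).1 ((PMF.mem_support_iff _ _).2 hne))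
    exact hu ⟨s', rfl⟩

theorem compMDP_stepAverage_move (hM : M.NoDeadlock) (h : Realizes M A σ part strat seen)
    (ρ : (compMDP M A part strat).Strategy) {q : Q} {s : S} (hact : Active M A σ q s)
    (F : S × Q × Turn → ℝ) :
    stepAverage ((compMDP M A part strat).chain ρ) (s, q, Turn.system) F =
      stepAverage (M.chain (σ q)) s fun s' => F (s', q, Turn.requirement) := by
  obtain ⟨h1, h2⟩ := compMDP_chain_move hM h ρ hact
  exact stepAverage_of_injective (f := fun s' : S => (s', q, Turn.requirement))
    (fun _ _ h => (Prod.mk.inj h).1) h1 h2 F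

/-- The sets of states, in the composed model and in the composition with a protocol, at which
the current objective is satisfied, are reached with the same probability. -/
theorem reachProb_protocolMDP_eq (hM : M.NoDeadlock) (hA : A.IsPersistence)
    (h : Realizes M A σ part strat seen) (ρ : (compMDP M A part strat).Strategy)
    {Pr : Protocol S Act Q W} (hPr : IsInducedProtocol M A σ Pr)
    (κ : (protocolMDP M A Pr).Strategy) :
    reachProb ((protocolMDP M A Pr).chain κ) {v | SatObjective M A v.2 v.1} (A.init, M.init) =
      reachProb ((compMDP M A part strat).chain ρ) {v | SatObjective M A v.1 v.2.1}
        (M.init, A.init, Turn.requirement) := by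
  set T : Set (Q × S) := {v | SatObjective M A v.2 v.1}
  set T' : Set (S × Q × Turn) := {v | SatObjective M A v.1 v.2.1}
  have hmove : ∀ {q s}, Active M A σ q s → (∀ w ∈ A.contexts q, ¬ SatContext M A s w) →
      ∀ F, stepAverage ((protocolMDP M A Pr).chain κ) (q, s) F =
        stepAverage (M.chain (σ q)) s fun s' => F (q, s') := by
    intro q s hact hs F
    obtain ⟨h1, h2⟩ := protocolMDP_chain_move hM hPr κ hact hs
    exact stepAverage_of_injective (f := fun s' : S => (q, s'))
      (fun _ _ h => (Prod.mk.inj h).2) h1 h2 F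
  have hclosed := closedUnder_active hM hPr κ
  have hinit : (A.init, M.init) ∈ {v : Q × S | Active M A σ v.1 v.2} := Active.init
  have hinit' : (M.init, A.init, Turn.requirement) ∈ liveStates M A σ := ⟨Active.init, by simp⟩
  refine le_antisymm ?_ ?_
  -- The comparison function looks only at requirement turns; a protocol move is matched by two
  -- composed steps.
  · refine reachProb_le_of_superharmonic (T := T) (C := {v | Active M A σ v.1 v.2})
      (F := fun v => reachProb ((compMDP M A part strat).chain ρ) T' (v.2, v.1, Turn.requirement))
      hclosed (fun v _ => reachProb_nonneg _ _ _)
      (fun v _ hv => (reachProb_of_mem (T := T') (v := (v.2, v.1, Turn.requirement)) _ hv).ge)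
      ?_ hinit
    rintro ⟨q, s⟩ hact hT
    have hT' : ∀ t, (s, q, t) ∉ T' := fun _ h => hT h
    by_cases hs : ∃ w ∈ A.contexts q, SatContext M A s w
    · obtain ⟨w, ⟨q', hw⟩, hs⟩ := hs
      rw [stepAverage_of_support fun x hx => protocolMDP_support_switch hPr κ hact hw hs hx]
      rw [reachProb_of_notMem _ (hT' Turn.requirement), stepAverage_of_support fun x hx =>
        (compMDP_support_switch hA h ρ hact hw hs x).1 hx]
    · push Not at hs
      rw [hmove hact hs]
      rw [reachProb_of_notMem _ (hT' Turn.requirement), stepAverage_of_support fun x hx =>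
        (compMDP_support_stay h ρ hact hs x).1 hx, reachProb_of_notMem _ (hT' Turn.system),
        compMDP_stepAverage_move hM h ρ hact]
  -- Here the comparison function forgets the turn, so stutter steps leave it unchanged.
  · refine reachProb_le_of_superharmonic (T := T') (C := liveStates M A σ)
      (F := fun v => reachProb ((protocolMDP M A Pr).chain κ) T (v.2.1, v.1))
      (closedUnder_liveStates hM hA h ρ) (fun v _ => reachProb_nonneg _ _ _)
      (fun v _ hv => (reachProb_of_mem (T := T) (v := (v.2.1, v.1)) _ hv).ge) ?_ hinit'
    rintro ⟨s, q, t⟩ ⟨hact, hsys⟩ hT'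
    have hT : (q, s) ∉ T := hT'
    cases t with
    | system =>
      rw [compMDP_stepAverage_move hM h ρ hact, reachProb_of_notMem _ hT, hmove hact (hsys rfl)]
    | requirement =>
      by_cases hs : ∃ w ∈ A.contexts q, SatContext M A s w
      · obtain ⟨w, ⟨q', hw⟩, hs⟩ := hs
        rw [stepAverage_of_support fun x hx => (compMDP_support_switch hA h ρ hact hw hs x).1 hx]
        rw [reachProb_of_notMem _ hT, stepAverage_of_support fun x hx =>
          protocolMDP_support_switch hPr κ hact hw hs hx]
      · push Not at hs
        rw [stepAverage_of_support fun x hx => (compMDP_support_stay h ρ hact hs x).1 hx]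

end CompositionChain

/-! ### The value of the composed model -/

section CompositionValue

variable {S Act AP Q W : Type*} [Fintype S] [Fintype Q] {M : MDP S Act AP} {A : CAPTL S Q W}
  {part : Q → Q → Set S} {strat : Q → Option M.Strategy} {σ : Q → M.Strategy} {seen : Set Q}

/-- No context holds at value one, so the objective is kept, and its local strategy preserves value
one. -/
theorem closedUnder_active_satObjective (hM : M.NoDeadlock) (hA : A.IsPersistence)
    (hσ : ∀ q, ∀ s ∈ M.Reach M.init, M.IsLocalStrategy (A.objSet q) s (σ q)) (q : Q) :
    ClosedUnder (M.chain (σ q)) {s | Active M A σ q s ∧ SatObjective M A s q} := by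
  rintro s ⟨hact, hs⟩ u hu
  refine ⟨Active.move hact (fun w hw => hs.not_satContext hA hw)
    ((MDP.mem_support_chain (hM.enabled _ _)).1 hu), ?_⟩
  exact (MDP.closedUnder_persistenceValue_eq_one (MDP.closedUnder_reach hM (σ q) M.init) (hσ q) s
    ⟨hact.mem_reach, hs⟩ u hu).2

/-- If the composed model can only visit states at which `q` is active and `B_q` holds, then `q`
is satisfied. -/
theorem satObjective_of_mem_core (hM : M.NoDeadlock) (hA : A.IsPersistence)
    (hσ : ∀ q, ∀ s ∈ M.Reach M.init, M.IsLocalStrategy (A.objSet q) s (σ q))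
    (h : Realizes M A σ part strat seen) (ρ : (compMDP M A part strat).Strategy) {q : Q}
    {v : S × Q × Turn} (hv : v ∈ liveStates M A σ)
    (hc : v ∈ core ((compMDP M A part strat).chain ρ) {v | v.2.1 = q ∧ v.1 ∈ A.objSet q}) :
    SatObjective M A v.1 v.2.1 := by
  set K := (compMDP M A part strat).chain ρ
  set D : Set (S × Q × Turn) := {v | v.2.1 = q ∧ v.1 ∈ A.objSet q}
  have hlive := closedUnder_liveStates hM hA h ρ
  have hcore := closedUnder_core K D
  -- The layer of `q` in the core, projected to system states, is closed under `σ q`: a context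
  -- holding there would lead to `q' = q` because the core is not left, and `next_ne` forbids this.
  have hclosed : ClosedUnder (M.chain (σ q))
      {s | ∃ t, (s, q, t) ∈ core K D ∧ (s, q, t) ∈ liveStates M A σ} := by
    rintro s ⟨t, hst, hl⟩ u hu
    have hsys : (s, q, Turn.system) ∈ core K D ∧ (s, q, Turn.system) ∈ liveStates M A σ := by
      cases t with
      | system => exact ⟨hst, hl⟩
      | requirement =>
        by_cases hs : ∃ w ∈ A.contexts q, SatContext M A s w
        · obtain ⟨w, ⟨q', hw⟩, hs⟩ := hs
          have hD := core_subset K D (hcore _ hst _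
            ((compMDP_support_switch hA h ρ hl.1 hw hs _).2 rfl))
          have hq : q' = q := hD.1
          exact absurd (hq ▸ hw) (hA.next_ne q w)
        · push Not at hs
          have hsupp := (compMDP_support_stay h ρ hl.1 hs _).2 rfl
          exact ⟨hcore _ hst _ hsupp, hlive _ hl _ hsupp⟩
    have hsupp : (u, q, Turn.requirement) ∈ (K (s, q, Turn.system)).support := by
      rw [PMF.mem_support_iff, (compMDP_chain_move hM h ρ hl.1).1, ← PMF.mem_support_iff]
      exact hu
    exact ⟨Turn.requirement, hcore _ hsys.1 _ hsupp, hlive _ hsys.2 _ hsupp⟩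
  obtain ⟨s, q', t⟩ := v
  obtain rfl : q' = q := (core_subset K D hc).1
  have hmem : s ∈ core (M.chain (σ q')) (A.objSet q') :=
    subset_core hclosed (fun s ⟨t, ht, _⟩ => (core_subset K D ht).2) ⟨t, hc, hv⟩
  change M.persistenceValue (A.objSet q') s = 1
  rw [MDP.persistenceValue_eq_reachProb (hσ q') hv.1.mem_reach, reachProb_of_mem _ hmem]

/-- From a state at which `q` is satisfied, the composed model almost surely comes to visit only
states at which `q` is active and `B_q` holds. -/
theorem one_le_reachProb_core (hM : M.NoDeadlock) (hA : A.IsPersistence)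
    (hσ : ∀ q, ∀ s ∈ M.Reach M.init, M.IsLocalStrategy (A.objSet q) s (σ q))
    (h : Realizes M A σ part strat seen) (ρ : (compMDP M A part strat).Strategy)
    {v : S × Q × Turn} (hv : v ∈ liveStates M A σ) (hs : SatObjective M A v.1 v.2.1) :
    1 ≤ reachProb ((compMDP M A part strat).chain ρ)
      (⋃ q, core ((compMDP M A part strat).chain ρ) {v | v.2.1 = q ∧ v.1 ∈ A.objSet q}) v := by
  obtain ⟨s, q, t⟩ := v
  set K := (compMDP M A part strat).chain ρ
  set U := ⋃ q, core K {v | v.2.1 = q ∧ v.1 ∈ A.objSet q}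
  -- On `Z` no context holds, so in the layer of `q` the composed model is the chain of `σ q` with
  -- stutter steps inserted.
  set Z : Set S := {s | Active M A σ q s ∧ SatObjective M A s q}
  have hZ : ClosedUnder (M.chain (σ q)) Z := closedUnder_active_satObjective hM hA hσ q
  have hnot : ∀ s ∈ Z, ∀ w ∈ A.contexts q, ¬ SatContext M A s w :=
    fun s hs w hw => hs.2.not_satContext hA hw
  have hsucc : ∀ s ∈ Z, ∀ u, u ∈ (K (s, q, Turn.system)).support →
      ∃ s' ∈ (M.chain (σ q) s).support, (s', q, Turn.requirement) = u := by
    intro s hs u hu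
    obtain ⟨h1, h2⟩ := compMDP_chain_move hM h ρ hs.1
    by_cases hr : u ∈ Set.range (fun s' => (s', q, Turn.requirement))
    · obtain ⟨s', rfl⟩ := hr
      refine ⟨s', ?_, rfl⟩
      rwa [PMF.mem_support_iff, ← h1, ← PMF.mem_support_iff]
    · exact absurd (h2 u hr) ((PMF.mem_support_iff _ _).1 hu)
  have hcoreU : ∀ s ∈ Z, s ∈ core (M.chain (σ q)) (A.objSet q) →
      (s, q, Turn.requirement) ∈ U := by
    intro s hs hc
    have hclosed : ClosedUnder K
        {v | v.2.1 = q ∧ v.1 ∈ Z ∧ v.1 ∈ core (M.chain (σ q)) (A.objSet q)} := by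
      rintro ⟨s, q', t⟩ ⟨hq, hsZ, hsc⟩ u hu
      obtain rfl : q' = q := hq
      cases t with
      | system =>
        obtain ⟨s', hs', rfl⟩ := hsucc s hsZ u hu
        exact ⟨rfl, hZ s hsZ s' hs', closedUnder_core _ _ s hsc s' hs'⟩
      | requirement =>
        obtain rfl := (compMDP_support_stay h ρ hsZ.1 (hnot s hsZ) u).1 hu
        exact ⟨rfl, hsZ, hsc⟩
    have hsub : {v : S × Q × Turn | v.2.1 = q ∧ v.1 ∈ Z ∧
        v.1 ∈ core (M.chain (σ q)) (A.objSet q)} ⊆ {v | v.2.1 = q ∧ v.1 ∈ A.objSet q} :=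
      fun v hv => ⟨hv.1, core_subset _ _ hv.2.2⟩
    have hmem : (s, q, Turn.requirement) ∈ {v : S × Q × Turn | v.2.1 = q ∧ v.1 ∈ Z ∧
        v.1 ∈ core (M.chain (σ q)) (A.objSet q)} := ⟨rfl, hs, hc⟩
    exact Set.mem_iUnion.2 ⟨q, subset_core hclosed hsub hmem⟩
  -- Under `σ q` the core of `B_q` is reached from `Z` with probability one. The composed
  -- probability of reaching `U` is superharmonic for that chain on `Z`, by two composed steps, and
  -- hence dominates this one.
  have hreq : ∀ s ∈ Z, 1 ≤ reachProb K U (s, q, Turn.requirement) := by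
    intro s hs
    have h1 : reachProb (M.chain (σ q)) (core (M.chain (σ q)) (A.objSet q)) s = 1 := by
      rw [← MDP.persistenceValue_eq_reachProb (hσ q) hs.1.mem_reach]
      exact hs.2
    rw [← h1]
    refine reachProb_le_of_superharmonic (C := Z)
      (F := fun s => reachProb K U (s, q, Turn.requirement)) hZ
      (fun _ _ => reachProb_nonneg _ _ _)
      (fun s hs hc => (reachProb_of_mem K (hcoreU s hs hc)).ge) (fun s hs _ => ?_) hs
    rw [← compMDP_stepAverage_move hM h ρ hs.1]
    refine (stepAverage_reachProb_le K U (s, q, Turn.system)).trans ?_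
    have := stepAverage_reachProb_le K U (s, q, Turn.requirement)
    rwa [stepAverage_of_support fun x hx =>
      (compMDP_support_stay h ρ hs.1 (hnot s hs) x).1 hx] at this
  have hsZ : s ∈ Z := ⟨hv.1, hs⟩
  cases t with
  | requirement => exact hreq s hsZ
  | system =>
    refine le_trans ?_ (stepAverage_reachProb_le K U (s, q, Turn.system))
    rw [← stepAverage_const K (s, q, Turn.system) 1]
    refine stepAverage_mono fun u hu => ?_
    obtain ⟨s', hs', rfl⟩ := hsucc s hsZ u hu
    exact hreq s' (hZ s hsZ s' hs')

/-- The probability of the objective of the composed model is the probability of reaching a state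
at which the current objective is satisfied. -/
theorem prob_compEvent (hM : M.NoDeadlock) (hA : A.IsPersistence)
    (hσ : ∀ q, ∀ s ∈ M.Reach M.init, M.IsLocalStrategy (A.objSet q) s (σ q))
    (h : Realizes M A σ part strat seen) (ρ : (compMDP M A part strat).Strategy) :
    (compMDP M A part strat).prob ρ (M.init, A.init, Turn.requirement) (compEvent A) =
      reachProb ((compMDP M A part strat).chain ρ) {v | SatObjective M A v.1 v.2.1}
        (M.init, A.init, Turn.requirement) := by
  have hinit : (M.init, A.init, Turn.requirement) ∈ liveStates M A σ :=
    ⟨Active.init, fun ht => by cases ht⟩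
  have hlive := closedUnder_liveStates hM hA h ρ
  have hev := pathProb_iUnion_eventuallyAlways ((compMDP M A part strat).chain ρ)
    (fun q : Q => {v : S × Q × Turn | v.2.1 = q ∧ v.1 ∈ A.objSet q})
    (M.init, A.init, Turn.requirement)
  refine hev.trans ?_
  set K := (compMDP M A part strat).chain ρ
  set T : Set (S × Q × Turn) := {v | SatObjective M A v.1 v.2.1}
  set U := ⋃ q, core K {v | v.2.1 = q ∧ v.1 ∈ A.objSet q}
  refine le_antisymm ?_ ?_
  -- Reaching `T` has probability one from the live states of `U`, and reaching `U` has probability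
  -- one from those of `T`; being superharmonic, each probability dominates the other.
  · refine reachProb_le_of_superharmonic (F := reachProb K T) (T := U) hlive
      (fun _ _ => reachProb_nonneg _ _ _) (fun v hv hU => ?_)
      (fun v _ _ => stepAverage_reachProb_le K T v) hinit
    obtain ⟨q, hq⟩ := Set.mem_iUnion.1 hU
    have hT : v ∈ T := satObjective_of_mem_core hM hA hσ h ρ hv hq
    exact (reachProb_of_mem K hT).ge
  · exact reachProb_le_of_superharmonic (F := reachProb K U) (T := T) hlive
      (fun _ _ => reachProb_nonneg _ _ _)
      (fun v hv hs => one_le_reachProb_core hM hA hσ h ρ hv hs)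
      (fun v _ _ => stepAverage_reachProb_le K U v) hinit

/-- The value that the composed model assigns to its objective is the one with which the protocol
satisfies the requirement. -/
theorem satisfies_iff (hM : M.NoDeadlock) (hA : A.IsPersistence)
    (hσ : ∀ q, ∀ s ∈ M.Reach M.init, M.IsLocalStrategy (A.objSet q) s (σ q))
    (h : Realizes M A σ part strat seen) (ρ : (compMDP M A part strat).Strategy)
    {Pr : Protocol S Act Q W} (hPr : IsInducedProtocol M A σ Pr) (c : ℝ) :
    Satisfies M A Pr c ↔
      (compMDP M A part strat).prob ρ (M.init, A.init, Turn.requirement) (compEvent A) = c := by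
  -- The protocol composition must have a strategy: otherwise the supremum would be zero by
  -- convention rather than the common value.
  have : Nonempty Act := (hM M.init).nonempty
  rw [prob_compEvent hM hA hσ h ρ, Satisfies, MDP.maxProb]
  have hκ : ∀ κ : (protocolMDP M A Pr).Strategy,
      (protocolMDP M A Pr).prob κ (A.init, M.init) {ω | ∃ n, SatObjective M A (ω n).2 (ω n).1} =
        reachProb ((compMDP M A part strat).chain ρ) {v | SatObjective M A v.1 v.2.1}
          (M.init, A.init, Turn.requirement) :=
    reachProb_protocolMDP_eq hM hA h ρ hPr
  simp only [hκ, ciSup_const]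

end CompositionValue

/-! ### Invariants and termination of the procedure -/

section Procedure

variable {S Act AP Q W : Type*} [Fintype S] [Fintype Q] {M : MDP S Act AP} {A : CAPTL S Q W}

/-- The invariant of the store: `pending q w` says that the context `w` of `q` has yet to be
treated, `ok q τ` is a property of the strategies returned by the model checker. -/
structure Store.Invariant (A : CAPTL S Q W) (ok : Q → M.Strategy → Prop)
    (pending : Q → W → Prop) (st : Store M Q) : Prop where
  disjoint : ∀ q ∈ st.todo, q ∉ st.seen
  init_mem : A.init ∈ st.todo ∨ A.init ∈ st.seen
  strat_ok : ∀ q ∈ st.seen, ∃ τ, st.strat q = some τ ∧ ok q τ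
  val_eq : ∀ q ∈ st.seen, st.val q = M.persistenceValue (A.objSet q)
  mem_part : ∀ q ∈ st.seen, ∀ w q', A.next q w = some q' → ¬ pending q w →
    ∀ s, s ∈ st.part q q' ↔ s ∈ M.Reach M.init ∧ SatContext M A s w
  mem_part_self : ∀ q ∈ st.seen, ∀ s, s ∈ st.part q q ↔
    s ∈ M.Reach M.init ∧ ∀ w ∈ A.contexts q, ¬ pending q w → ¬ SatContext M A s w
  next_mem : ∀ q ∈ st.seen, ∀ w q', A.next q w = some q' → ¬ pending q w →
    (st.part q q').Nonempty → q' ∈ st.todo ∨ q' ∈ st.seen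

/-- The invariant of the configurations. -/
def Config.Invariant (A : CAPTL S Q W) (ok : Q → M.Strategy → Prop) : Config M Q W → Prop
  | .whileLoop st => st.Invariant A ok fun _ _ => False
  | .forLoop st q rest => q ∈ st.seen ∧ rest ⊆ A.contexts q ∧
      st.Invariant A ok fun p w => p = q ∧ w ∈ rest
  | .built N => ∃ st : Store M Q, (st.Invariant A ok fun _ _ => False) ∧ st.todo = ∅ ∧
      N = compMDP M A st.part st.strat
  | .returned Pr c => ∃ st : Store M Q, (st.Invariant A ok fun _ _ => False) ∧ st.todo = ∅ ∧
      ∃ ρ : (compMDP M A st.part st.strat).Strategy, Pr = readProtocol _ ρ ∧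
        c = (compMDP M A st.part st.strat).prob ρ (M.init, A.init, Turn.requirement)
          (compEvent A)

variable {ok : Q → M.Strategy → Prop}

theorem Config.invariant_start : (Config.start M A : Config M Q W).Invariant A ok where
  disjoint _ _ := Set.notMem_empty _
  init_mem := Or.inl rfl
  strat_ok _ h := h.elim
  val_eq _ h := h.elim
  mem_part _ h := h.elim
  mem_part_self _ h := h.elim
  next_mem _ h := h.elim

/-- All contexts of `q` are now pending, so its row has only to satisfy `R_q^q = R`; the other rows
are untouched. -/
theorem Store.Invariant.enter {st : Store M Q} (h : st.Invariant A ok fun _ _ => False)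
    {q : Q} {τ : M.Strategy} (hτ : ok q τ) :
    (st.enter A q τ).Invariant A ok fun p w => p = q ∧ w ∈ A.contexts q := by
  have hcase : ∀ p ∈ (st.enter A q τ).seen, p = q ∨ p ≠ q ∧ p ∈ st.seen := by
    intro p hp
    by_cases hpq : p = q
    · exact Or.inl hpq
    · exact Or.inr ⟨hpq, hp.resolve_right hpq⟩
  have hmem : ∀ p, p ∈ st.todo ∨ p ∈ st.seen →
      p ∈ (st.enter A q τ).todo ∨ p ∈ (st.enter A q τ).seen := by
    intro p hp
    by_cases hpq : p = q
    · exact Or.inr (Or.inr hpq)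
    · exact hp.imp (fun h => ⟨h, hpq⟩) Or.inl
  have hpart : ∀ p, p ≠ q → (st.enter A q τ).part p = st.part p := fun p hp => by
    simp [Store.enter, hp]
  constructor
  · rintro p ⟨hp, hpq⟩ (hs | hs)
    · exact h.disjoint p hp hs
    · exact hpq hs
  · exact hmem _ h.init_mem
  · intro p hp
    obtain rfl | ⟨hpq, hp⟩ := hcase p hp
    · exact ⟨τ, by simp [Store.enter], hτ⟩
    · obtain ⟨τ', h1, h2⟩ := h.strat_ok p hp
      exact ⟨τ', by simpa [Store.enter, hpq] using h1, h2⟩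
  · intro p hp
    obtain rfl | ⟨hpq, hp⟩ := hcase p hp
    · simp [Store.enter]
    · simpa [Store.enter, hpq] using h.val_eq p hp
  · intro p hp w q' hw hpend s
    obtain rfl | ⟨hpq, hp⟩ := hcase p hp
    · exact absurd ⟨rfl, CAPTL.mem_contexts hw⟩ hpend
    · rw [hpart p hpq]
      exact h.mem_part p hp w q' hw id s
  · intro p hp s
    obtain rfl | ⟨hpq, hp⟩ := hcase p hp
    · have : (st.enter A p τ).part p p = M.Reach M.init := by
        simp [Store.enter]
      rw [this]
      exact ⟨fun hs => ⟨hs, fun w hw hpend => absurd ⟨rfl, hw⟩ hpend⟩, And.left⟩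
    · rw [hpart p hpq, h.mem_part_self p hp s]
      exact and_congr_right fun _ => forall₂_congr fun w hw => by simp [hpq]
  · intro p hp w q' hw hpend hne
    obtain rfl | ⟨hpq, hp⟩ := hcase p hp
    · exact absurd ⟨rfl, CAPTL.mem_contexts hw⟩ hpend
    · rw [hpart p hpq] at hne
      exact hmem _ (h.next_mem p hp w q' hw id hne)

/-- By `next_inj` no other context of `q` uses the cell being written, and by `next_ne` it is not
the diagonal cell. Earlier results therefore survive, and the subtraction from `R_q^q` removes
exactly the states satisfying `w`. -/
theorem Store.Invariant.treat (hA : A.IsPersistence) {st : Store M Q} {q q' : Q} {rest : Set W}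
    {w : W} (hq : q ∈ st.seen) (h : st.Invariant A ok fun p w => p = q ∧ w ∈ rest)
    (hw : A.next q w = some q') :
    (st.treat A q w q').Invariant A ok fun p u => p = q ∧ u ∈ rest \ {w} := by
  have hne : q' ≠ q := fun h => hA.next_ne q w (h ▸ hw)
  have hnew : ∀ s, (s ∈ M.Reach M.init ∧ st.val q s ∈ A.ctxInt w) ↔
      s ∈ M.Reach M.init ∧ SatContext M A s w := fun s => by
    rw [h.val_eq q hq, satContext_iff hA (CAPTL.mem_contexts hw)]
  have hpart : ∀ p, p ≠ q → (st.treat A q w q').part p = st.part p := fun p hp => by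
    simp [Store.treat, hp]
  have hpart' : ∀ s, s ∈ (st.treat A q w q').part q q' ↔
      s ∈ M.Reach M.init ∧ SatContext M A s w := fun s => by
    rw [← hnew]
    simp [Store.treat, hne]
  have hself : ∀ s, s ∈ (st.treat A q w q').part q q ↔ s ∈ st.part q q ∧
      ¬ (s ∈ M.Reach M.init ∧ SatContext M A s w) := fun s => by
    rw [← hnew]
    simp [Store.treat, hne.symm]
  have hother : ∀ p, p ≠ q' → p ≠ q → (st.treat A q w q').part q p = st.part q p :=
    fun p hp hpq => by simp [Store.treat, hp, hpq]
  have hmem : ∀ p, p ∈ st.todo ∨ p ∈ st.seen →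
      p ∈ (st.treat A q w q').todo ∨ p ∈ (st.treat A q w q').seen := by
    rintro p (hp | hp)
    · left
      simp only [Store.treat]
      split_ifs
      · exact Or.inl hp
      · exact hp
    · exact Or.inr hp
  have hpend : ∀ {u}, ¬ (q = q ∧ u ∈ rest \ {w}) → u ≠ w → ¬ (q = q ∧ u ∈ rest) :=
    fun hu hne hr => hu ⟨rfl, hr.2, hne⟩
  constructor
  · intro p hp
    simp only [Store.treat] at hp
    split_ifs at hp with hc
    · rcases hp with hp | rfl
      · exact h.disjoint p hp
      · exact hc.2
    · exact h.disjoint p hp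
  · exact hmem _ h.init_mem
  · exact h.strat_ok
  · exact h.val_eq
  · intro p hp u p' hu hpd s
    by_cases hpq : p = q
    · subst hpq
      by_cases huw : u = w
      · subst huw
        rw [hw] at hu
        obtain rfl := Option.some_injective _ hu
        exact hpart' s
      · rw [hother p' (fun hp' => huw (hA.next_inj p u w q' (hp' ▸ hu) hw))
          (fun hp' => hA.next_ne p u (hp' ▸ hu))]
        exact h.mem_part p hp u p' hu (hpend hpd huw) s
    · rw [hpart p hpq]
      exact h.mem_part p hp u p' hu (fun hc => hpq hc.1) s
  · intro p hp s
    by_cases hpq : p = q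
    · subst hpq
      rw [hself, h.mem_part_self p hp s]
      constructor
      · rintro ⟨⟨hs, h1⟩, h2⟩
        refine ⟨hs, fun u hu hpd => ?_⟩
        by_cases huw : u = w
        · exact huw ▸ fun hsat => h2 ⟨hs, hsat⟩
        · exact h1 u hu (hpend hpd huw)
      · rintro ⟨hs, h1⟩
        refine ⟨⟨hs, fun u hu hpd => h1 u hu fun hc => hpd ⟨rfl, hc.2.1⟩⟩, fun hc => ?_⟩
        exact h1 w (CAPTL.mem_contexts hw) (fun hc => hc.2.2 rfl) hc.2
    · rw [hpart p hpq, h.mem_part_self p hp s]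
      exact and_congr_right fun _ => forall₂_congr fun w hw => by simp [hpq]
  · intro p hp u p' hu hpd hn
    by_cases hpq : p = q
    · subst hpq
      by_cases huw : u = w
      · subst huw
        rw [hw] at hu
        obtain rfl := Option.some_injective _ hu
        by_cases hseen : q' ∈ st.seen
        · exact Or.inr hseen
        · left
          have hc : {s | s ∈ M.Reach M.init ∧ st.val p s ∈ A.ctxInt u}.Nonempty ∧
              q' ∉ st.seen := by
            obtain ⟨s, hs⟩ := hn
            exact ⟨⟨s, (hnew s).2 ((hpart' s).1 hs)⟩, hseen⟩
          simp only [Store.treat]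
          rw [if_pos hc]
          exact Or.inr rfl
      · rw [hother p' (fun hp' => huw (hA.next_inj p u w q' (hp' ▸ hu) hw))
          (fun hp' => hA.next_ne p u (hp' ▸ hu))] at hn
        exact hmem _ (h.next_mem p hp u p' hu (hpend hpd huw) hn)
    · rw [hpart p hpq] at hn
      exact hmem _ (h.next_mem p hp u p' hu (fun hc => hpq hc.1) hn)

theorem Store.Invariant.leave {st : Store M Q} {q : Q}
    (h : st.Invariant A ok fun p w => p = q ∧ w ∈ (∅ : Set W)) :
    st.Invariant A ok fun _ _ => False := by
  have : (fun (p : Q) (w : W) => p = q ∧ w ∈ (∅ : Set W)) = fun _ _ => False := by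
    funext p w
    simp
  rwa [this] at h

/-- The strategies that are optimal for an objective at all reachable states. -/
abbrev IsReachableOptimal (M : MDP S Act AP) (A : CAPTL S Q W) (q : Q) (τ : M.Strategy) : Prop :=
  ∀ s ∈ M.Reach M.init, M.IsLocalStrategy (A.objSet q) s τ

theorem Step.invariant (hA : A.IsPersistence) {C C' : Config M Q W} (hstep : Step M A C C')
    (h : C.Invariant A (IsReachableOptimal M A)) : C'.Invariant A (IsReachableOptimal M A) := by
  cases hstep with
  | enter hq hτ => exact ⟨Or.inr rfl, subset_rfl, Store.Invariant.enter h hτ⟩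
  | treat hw hnext =>
    exact ⟨h.1, Set.sdiff_subset.trans h.2.1, Store.Invariant.treat hA h.1 h.2.2 hnext⟩
  | leave => exact h.2.2.leave
  | build htodo => exact ⟨_, h, htodo, rfl⟩
  | synth ρ =>
    obtain ⟨st, hst, htodo, rfl⟩ := h
    exact ⟨st, hst, htodo, ρ, rfl, rfl⟩

/-- A configuration that has not returned a result has a successor; the strategies of the model
checker may be taken from any family of correct ones. -/
theorem Config.Invariant.exists_step (hA : A.IsPersistence)
    (hok : ∀ q, ∃ τ, ok q τ) (hopt : ∀ q τ, ok q τ → IsReachableOptimal M A q τ)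
    {C : Config M Q W} (h : C.Invariant A ok) :
    C.IsReturned ∨ ∃ C', Step M A C C' ∧ C'.Invariant A ok := by
  cases C with
  | whileLoop st =>
    right
    rcases st.todo.eq_empty_or_nonempty with htodo | ⟨q, hq⟩
    · exact ⟨_, Step.build htodo, st, h, htodo, rfl⟩
    · obtain ⟨τ, hτ⟩ := hok q
      exact ⟨_, Step.enter hq (hopt q τ hτ), Or.inr rfl, subset_rfl, Store.Invariant.enter h hτ⟩
  | forLoop st q rest =>
    right
    obtain ⟨hq, hrest, hinv⟩ := h
    rcases rest.eq_empty_or_nonempty with rfl | ⟨w, hw⟩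
    · exact ⟨_, Step.leave, hinv.leave⟩
    · obtain ⟨q', hnext⟩ := hrest hw
      exact ⟨_, Step.treat hw hnext, hq, Set.sdiff_subset.trans hrest, hinv.treat hA hq hnext⟩
  | built N =>
    right
    obtain ⟨st, hst, htodo, rfl⟩ := h
    have ρ : Nonempty (compMDP M A st.part st.strat).Strategy := by
      have : Nonempty (CompAct Act W) := ⟨CompAct.tau⟩
      infer_instance
    exact ⟨_, Step.synth ρ.some, st, hst, htodo, ρ.some, rfl, rfl⟩
  | returned Pr c => exact Or.inl trivial

/-- A bound on the number of remaining steps. -/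
noncomputable def Config.steps : Config M Q W → ℕ
  -- Each unseen objective pays for entering, for at most `Nat.card W` contexts, and for leaving;
  -- the final `2` pays for building and synthesis. Inside the for loop, leaving is still due as
  -- well, hence `3`.
  | .whileLoop st => st.seenᶜ.ncard * (Nat.card W + 2) + 2
  | .forLoop st _ rest => st.seenᶜ.ncard * (Nat.card W + 2) + rest.ncard + 3
  | .built _ => 1
  | .returned _ _ => 0

theorem Step.steps_lt [Finite W] {C C' : Config M Q W} (hstep : Step M A C C')
    (h : C.Invariant A ok) : C'.steps < C.steps := by
  cases hstep with
  | @enter st q τ hq hτ =>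
    have hlt : (st.enter A q τ).seenᶜ.ncard < st.seenᶜ.ncard := by
      refine Set.ncard_lt_ncard (Set.ssubset_iff_of_subset ?_ |>.2 ⟨q, ?_, ?_⟩) (Set.toFinite _)
      · exact Set.compl_subset_compl.2 fun p hp => Or.inl hp
      · exact Store.Invariant.disjoint h q hq
      · exact fun hc => hc (Or.inr rfl)
    have hcard : (A.contexts q).ncard ≤ Nat.card W := Set.ncard_le_card _
    have := Nat.mul_le_mul_right (Nat.card W + 2) hlt
    simp only [Config.steps]
    rw [Nat.succ_mul] at this
    omega
  | @treat st q rest w q' hw hnext =>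
    have := Set.ncard_sdiff_singleton_lt_of_mem hw (Set.toFinite _)
    have hseen : (st.treat A q w q').seen = st.seen := rfl
    simp only [Config.steps, hseen]
    omega
  | leave => simp only [Config.steps]; omega
  | build htodo => simp only [Config.steps]; omega
  | synth ρ => simp only [Config.steps]; omega

/-- Keeping `ok` arbitrary allows the answers of the model checker to be prescribed, for instance as
those of a given profile. -/
theorem Config.Invariant.exists_returned [Finite W] (hA : A.IsPersistence)
    (hok : ∀ q, ∃ τ, ok q τ) (hopt : ∀ q τ, ok q τ → IsReachableOptimal M A q τ)
    {C : Config M Q W} (h : C.Invariant A ok) :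
    ∃ Pr c, Relation.ReflTransGen (Step M A) C (.returned Pr c) ∧
      (Config.returned Pr c : Config M Q W).Invariant A ok := by
  induction hn : C.steps using Nat.strong_induction_on generalizing C with
  | _ n ih =>
    rcases h.exists_step hA hok hopt with hret | ⟨C', hstep, h'⟩
    · cases C with
      | returned Pr c => exact ⟨Pr, c, .refl, h⟩
      | _ => exact hret.elim
    · obtain ⟨Pr, c, hr, hinv⟩ := ih _ (hn ▸ hstep.steps_lt h) h' rfl
      exact ⟨Pr, c, .head hstep hr, hinv⟩

theorem Step.invariant_of_reachable (hA : A.IsPersistence) {C C' : Config M Q W}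
    (hr : Relation.ReflTransGen (Step M A) C C')
    (h : C.Invariant A (IsReachableOptimal M A)) : C'.Invariant A (IsReachableOptimal M A) := by
  induction hr with
  | refl => exact h
  | tail _ hstep ih => exact hstep.invariant hA ih

theorem terminates [Finite Act] [Finite W] (hM : M.NoDeadlock) (hA : A.IsPersistence) :
    Terminates M A := by
  refine ⟨?_, fun C hC => ?_⟩
  · rintro ⟨f, h0, hf⟩
    have hinv : ∀ n, (f n).Invariant A (IsReachableOptimal M A) := by
      intro n
      induction n with
      | zero => exact h0 ▸ Config.invariant_start
      | succ n ih => exact (hf n).invariant hA ih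
    have hbound : ∀ n, (f n).steps + n ≤ (f 0).steps := by
      intro n
      induction n with
      | zero => rfl
      | succ n ih =>
        have := (hf n).steps_lt (hinv n)
        omega
    have := hbound ((f 0).steps + 1)
    omega
  · have h := Step.invariant_of_reachable hA hC Config.invariant_start
    refine (h.exists_step hA (fun q => ?_) fun _ _ h => h).imp_right
      fun ⟨C', hs, _⟩ => ⟨C', hs⟩
    obtain ⟨τ, hτ⟩ := MDP.exists_isLocalStrategy hM (A.objSet q)
    exact ⟨τ, fun s _ => hτ s⟩

/-- With nothing waiting, "waiting or seen" becomes "seen", so the processed objectives are closed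
under the switches that can occur. -/
theorem Store.Invariant.realizes {st : Store M Q} (h : st.Invariant A ok fun _ _ => False)
    (htodo : st.todo = ∅) {σ : Q → M.Strategy} (hσ : ∀ q ∈ st.seen, st.strat q = some (σ q)) :
    Realizes M A σ st.part st.strat st.seen where
  init_mem := h.init_mem.resolve_left fun hq => by simp [htodo] at hq
  strat_eq := hσ
  mem_part q hq w q' hw := h.mem_part q hq w q' hw id
  mem_part_self q hq s := by simpa using h.mem_part_self q hq s
  next_mem q hq w q' hw hne := (h.next_mem q hq w q' hw id hne).resolve_left fun hq => by
    simp [htodo] at hq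

end Procedure

/-! ### Termination, soundness and completeness -/

theorem theorem2 {S Act AP Q W : Type*} [Fintype S] [Finite Act] [Fintype Q] [Finite W]
    (M : MDP S Act AP) (hM : M.NoDeadlock) (A : CAPTL S Q W) (hA : A.IsPersistence) :
    Terminates M A ∧
      ∀ (Pr : Protocol S Act Q W) (c : ℝ),
        Returns M A Pr c ↔ IsOptimalProtocol M A Pr ∧ Satisfies M A Pr c := by
  refine ⟨terminates hM hA, fun Pr c => ⟨fun hret => ?_, ?_⟩⟩
  · obtain ⟨st, hst, htodo, ρ, rfl, rfl⟩ :=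
      Step.invariant_of_reachable hA hret Config.invariant_start
    -- An optimal profile needs a strategy for every objective; objectives never processed have none
    -- stored and receive any optimal one.
    have hex : ∀ q, ∃ τ : M.Strategy,
        IsReachableOptimal M A q τ ∧ (q ∈ st.seen → st.strat q = some τ) := by
      intro q
      by_cases hq : q ∈ st.seen
      · obtain ⟨τ, h1, h2⟩ := hst.strat_ok q hq
        exact ⟨τ, h2, fun _ => h1⟩
      · obtain ⟨τ, hτ⟩ := MDP.exists_isLocalStrategy hM (A.objSet q)
        exact ⟨τ, fun s _ => hτ s, fun h => absurd h hq⟩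
    choose σ hσ hstrat using hex
    have hreal := hst.realizes htodo hstrat
    have hind := isInducedProtocol_readProtocol hM hA hreal ρ
    exact ⟨⟨σ, hσ, hind⟩, (satisfies_iff hM hA hσ hreal ρ hind _).2 rfl⟩
  · rintro ⟨⟨σ, hσ, hind⟩, hsat⟩
    have hstart : (Config.start M A : Config M Q W).Invariant A fun q τ => τ = σ q :=
      Config.invariant_start
    -- This run uses the answers `σ q`. Its protocol is induced by `σ`, as `Pr` is, so the two
    -- coincide, and `satisfies_iff` identifies the returned value with `c`.
    obtain ⟨Pr', c', hr, st, hst, htodo, ρ, rfl, rfl⟩ :=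
      hstart.exists_returned hA (ok := fun q τ => τ = σ q)
      (fun q => ⟨σ q, rfl⟩) (by rintro q _ rfl; exact hσ q)
    have hreal := hst.realizes htodo (σ := σ) fun q hq => by
      obtain ⟨τ, h1, rfl⟩ := hst.strat_ok q hq
      exact h1
    have hind' := isInducedProtocol_readProtocol hM hA hreal ρ
    rw [hind.eq hind'] at hsat ⊢
    rwa [(satisfies_iff hM hA hσ hreal ρ hind' c).1 hsat] at hr
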